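/- Let $k$ be a finite field, $H$ a finite abelian group with $\operatorname{char}k\nmid |H|$, and $J$ a finite-dimensional nilpotent associative (non-unital) $k$-algebra with commuting $k$-linear left and right actions of $H$ satisfying $h(xy)=(hx)y$, $(xy)h=x(yh)$ and $x(hy)=(xh)y$ for $h\in H$, $x,y\in J$. The set $G=H+J=\{h+x : h\in H,\ x\in J\}$ with the multiplication $(h_1+x_1)(h_2+x_2)=h_1h_2+(h_1x_2+x_1h_2+x_1x_2)$ is a finite group, called a finite group of triangular type. Fix a nontrivial character $\varepsilon$ of the additive group of $k$ with values in $\mathbb C^*$. For an idempotent $e$ of the group algebra $kH$ (which acts on $J$ from both sides by linear extension) put $J_e=eJe$, $H(e)=\{h\in H: he=e\}$, $H_e=He$, $N_e=e+J_e$, and identify $J_e^*$ with the space of linear forms $\lambda\in J^*$ with $\lambda(x)=\lambda(exe)$ for all $x\in J$. Two forms in $J_e^*$ lie in the same orbit if one is carried to the other by the action on $J_e^*$ induced by some map $x\mapsto taxb^{-1}t^{-1}$ of $J_e$ with $t\in H_e$ and $a,b\in N_e$. An orbit in $J_e^*$ is called regular if it is disjoint from $J_f^*$ for every idempotent $f\ne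 e$ of $(kH)e$. Let $e\in kH$ be an idempotent, $\theta:H(e)\to\mathbb C^*$ a linear character, $\omega$ a regular orbit in $J_e^*$, and $\lambda\in\omega$. Put $J_{\lambda,\mathrm{right}}=\{x\in J:\lambda(xJ)=0\}$. Then $H(e)+J_{\lambda,\mathrm{right}}$ is a subgroup of $G$, with linear character $\xi_{\theta,\lambda}(h+x)=\theta(h)\varepsilon(\lambda(x))$. The supercharacters of $G$ are the induced characters $\operatorname{Ind}(\xi_{\theta,\lambda},\,H(e)+J_{\lambda,\mathrm{right}},\,G)$ for all such $e,\theta,\omega,\lambda$. Then the (pointwise) product of any two supercharacters of $G$ is a sum of supercharacters of $G$ with nonnegative integer coefficients. -/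

import Mathlib

open scoped RightActions

/-- The compatibility laws for the data from which a group `H + J` is built: a group `H` acts
additively from the left, `h •> x`, and from the right, `x <• h`, on the associative (non-unital)
ring `J`; the two actions commute (`SMulCommClass H Hᵐᵒᵖ J`), are compatible with the
multiplication of `J`, and `J` is nilpotent. -/
class IsTriangularPair (H J : Type*) [Group H] [NonUnitalRing J]
    [DistribMulAction H J] [DistribMulAction Hᵐᵒᵖ J] [SMulCommClass H Hᵐᵒᵖ J] : Prop where
  left_mul : ∀ (h : H) (x y : J), h •> (x * y) = (h •> x) * y
  right_mul : ∀ (h : H) (x y : J), (x * y) <• h = x * (y <• h)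
  mid_mul : ∀ (h : H) (x y : J), x * (h •> y) = (x <• h) * y
  /-- For some `n`, every product of `n + 1` elements of `J` vanishes. -/
  nilpotent : ∃ n : ℕ, ∀ (l : List J) (x : J), l.length = n → l.foldr (fun a b => a * b) x = 0

/-- The set `G = H + J` of formal sums `h + x`, `h ∈ H`, `x ∈ J`. -/
@[ext]
structure TriGroup (H J : Type*) where
  /-- the component in `H` -/
  h : H
  /-- the component in `J` -/
  x : J

set_option linter.unusedSectionVars false

namespace TriGroup

variable {H J : Type*} [Group H] [NonUnitalRing J]
  [DistribMulAction H J] [DistribMulAction Hᵐᵒᵖ J] [SMulCommClass H Hᵐᵒᵖ J]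

/-- `(h₁ + x₁)(h₂ + x₂) = h₁h₂ + (h₁x₂ + x₁h₂ + x₁x₂)`. -/
instance : Mul (TriGroup H J) :=
  ⟨fun g₁ g₂ => ⟨g₁.h * g₂.h, g₁.h •> g₂.x + g₁.x <• g₂.h + g₁.x * g₂.x⟩⟩

instance : One (TriGroup H J) := ⟨⟨1, 0⟩⟩

theorem mul_h (g₁ g₂ : TriGroup H J) : (g₁ * g₂).h = g₁.h * g₂.h := rfl

theorem mul_x (g₁ g₂ : TriGroup H J) :
    (g₁ * g₂).x = g₁.h •> g₂.x + g₁.x <• g₂.h + g₁.x * g₂.x := rfl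

theorem one_h : (1 : TriGroup H J).h = 1 := rfl

theorem one_x : (1 : TriGroup H J).x = 0 := rfl

variable [IsTriangularPair H J]

theorem exists_quasiInverse (H : Type*) {J : Type*} [Group H] [NonUnitalRing J]
    [DistribMulAction H J] [DistribMulAction Hᵐᵒᵖ J] [SMulCommClass H Hᵐᵒᵖ J]
    [IsTriangularPair H J] (y : J) : ∃ q : J, y + q + y * q = 0 := by
  obtain ⟨n, hn⟩ := IsTriangularPair.nilpotent (H := H) (J := J)
  have key : ∀ m : ℕ, ∃ q : J, ∃ l : List J, l.length = m ∧ ∃ z : J,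
      y + q + y * q = l.foldr (fun a b => a * b) z := by
    intro m
    induction m with
    | zero => exact ⟨0, [], rfl, y, by simp⟩
    | succ m ih =>
      obtain ⟨q, l, hl, z, hz⟩ := ih
      refine ⟨-y - y * q, (-y) :: l, by simp [hl], z, ?_⟩
      rw [List.foldr_cons, ← hz]
      noncomm_ring
  obtain ⟨q, l, hl, z, hz⟩ := key n
  exact ⟨q, by rw [hz, hn l z hl]⟩

theorem exists_right_inv (g : TriGroup H J) : ∃ g' : TriGroup H J, g * g' = 1 := by
  obtain ⟨q, hq⟩ := exists_quasiInverse H (g.h⁻¹ •> g.x)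
  refine ⟨⟨g.h⁻¹, q <• g.h⁻¹⟩, ?_⟩
  ext
  · simp [mul_h, one_h]
  · have e1 : g.x = g.h •> (g.h⁻¹ •> g.x) := by simp
    have e2 : g.h •> ((g.h⁻¹ •> g.x + q + (g.h⁻¹ •> g.x) * q) <• g.h⁻¹) = 0 := by
      rw [hq]; simp
    rw [smul_add, smul_add, smul_add, smul_add, IsTriangularPair.right_mul,
      IsTriangularPair.left_mul, ← e1, smul_comm g.h (MulOpposite.op g.h⁻¹) (g.h⁻¹ •> g.x),
      ← e1] at e2
    rw [mul_x, one_x, ← e2]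
    abel

noncomputable instance : Inv (TriGroup H J) := ⟨fun g => (exists_right_inv g).choose⟩

/-- `G = H + J` is a group, because `J` is nilpotent. -/
noncomputable instance : Group (TriGroup H J) :=
  Group.ofRightAxioms
    (by
      intro a b c
      ext
      · simp [mul_h, mul_assoc]
      · simp only [mul_x, mul_h, smul_add, add_mul, mul_add, mul_smul, MulOpposite.op_mul,
          IsTriangularPair.left_mul, IsTriangularPair.right_mul, IsTriangularPair.mid_mul,
          mul_assoc, smul_comm a.h (MulOpposite.op c.h) b.x]
        abel)
    (by intro a; ext <;> simp [mul_h, mul_x, one_h, one_x])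
    (fun a => (exists_right_inv a).choose_spec)

end TriGroup

namespace Triangular

section Pierce

variable {k H J : Type*} [Field k] [CommGroup H] [NonUnitalRing J] [Module k J]
  [DistribMulAction H J] [DistribMulAction Hᵐᵒᵖ J]
  [SMulCommClass H k J] [SMulCommClass Hᵐᵒᵖ k J]

/-- The right action of the commutative group `H` on `J` as a homomorphism `H → End J`. -/
def rightHom (k H J : Type*) [Field k] [CommGroup H] [NonUnitalRing J] [Module k J]
    [DistribMulAction Hᵐᵒᵖ J] [SMulCommClass Hᵐᵒᵖ k J] : H →* Module.End k J where
  toFun h := DistribSMul.toLinearMap k J (MulOpposite.op h)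
  map_one' := by ext x; simp
  map_mul' a b := by ext x; simp [mul_comm a b, mul_smul]

/-- The left action of `H` on `J` as a homomorphism `H → End J`. -/
def leftHom (k H J : Type*) [Field k] [CommGroup H] [NonUnitalRing J] [Module k J]
    [DistribMulAction H J] [SMulCommClass H k J] : H →* Module.End k J where
  toFun h := DistribSMul.toLinearMap k J h
  map_one' := by ext x; simp
  map_mul' a b := by ext x; simp [mul_smul]

/-- The map `x ↦ a x`, for `a` in the group algebra `kH` (linear extension of the left action). -/
noncomputable def lmul : MonoidAlgebra k H →ₐ[k] Module.End k J :=
  MonoidAlgebra.lift k (Module.End k J) H (leftHom k H J)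

/-- The map `x ↦ x a`, for `a` in the group algebra `kH` (linear extension of the right action). -/
noncomputable def rmul : MonoidAlgebra k H →ₐ[k] Module.End k J :=
  MonoidAlgebra.lift k (Module.End k J) H (rightHom k H J)

/-- The map `x ↦ e x e` on `J`, for `e ∈ kH`. -/
noncomputable def cornerMap (e : MonoidAlgebra k H) : J →ₗ[k] J := rmul e ∘ₗ lmul e

/-- The Pierce component `J_e = eJe`. -/
noncomputable def corner (e : MonoidAlgebra k H) : Submodule k J := LinearMap.range (cornerMap e)

/-- The dual `J_e^*`, as the subspace of the linear forms on `J` that vanish on the Pierce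
components `eJ(1-e)`, `(1-e)Je`, `(1-e)J(1-e)`, that is, of the `μ` with `μ(x) = μ(exe)`. -/
def dualCorner (e : MonoidAlgebra k H) : Set (Module.Dual k J) :=
  {μ | ∀ x : J, μ (cornerMap e x) = μ x}

/-- `H(e) = {h ∈ H : he = e}`. -/
def fixer (e : MonoidAlgebra k H) : Subgroup H where
  carrier := {h | MonoidAlgebra.of k H h * e = e}
  one_mem' := by simp [MonoidAlgebra.of_apply, ← MonoidAlgebra.one_def]
  mul_mem' := by
    intro a b ha hb
    simp only [Set.mem_ofPred_eq] at *
    rw [map_mul, mul_assoc, hb, ha]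
  inv_mem' := by
    intro a ha
    simp only [Set.mem_ofPred_eq] at *
    nth_rewrite 1 [← ha]
    rw [← mul_assoc, ← map_mul]
    simp [MonoidAlgebra.of_apply, ← MonoidAlgebra.one_def]

theorem apply_smul_of_mem_fixer {e : MonoidAlgebra k H} {μ : Module.Dual k J}
    (hμ : μ ∈ dualCorner e) {h : H} (hh : MonoidAlgebra.of k H h * e = e) (x : J) :
    μ (h •> x) = μ x := by
  have h1 : lmul e (h •> x) = lmul e x := by
    have : lmul (MonoidAlgebra.of k H h) x = h •> x := by
      simp [lmul, leftHom]
    rw [← this, ← Module.End.mul_apply, ← map_mul, mul_comm, hh]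
  rw [← hμ (h •> x), ← hμ x, cornerMap, LinearMap.comp_apply, LinearMap.comp_apply, h1]

end Pierce

section Orbits

variable {k H J : Type*} [Field k] [CommGroup H] [NonUnitalRing J] [Module k J]
  [DistribMulAction H J] [DistribMulAction Hᵐᵒᵖ J] [SMulCommClass H Hᵐᵒᵖ J]
  [SMulCommClass H k J] [SMulCommClass Hᵐᵒᵖ k J] [IsTriangularPair H J]

/-- The subset `{1 + u : u ∈ J_e}` of `G`. An element `1 + u` acts on `J_e`
(on both sides) as the element `e + u` of the algebra group `N_e = e + J_e`. -/
def unipotent (e : MonoidAlgebra k H) : Set (TriGroup H J) := {g | g.h = 1 ∧ g.x ∈ corner e}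

/-- `ρ_τ(x) = t a x b⁻¹ t⁻¹` for `τ = (t, a, b)`, where `a, b ∈ 1 + J`. -/
noncomputable def rho (t : H) (a b : TriGroup H J) (x : J) : J :=
  let y := a.h •> x + a.x * x
  let z := y <• (b⁻¹).h + y * (b⁻¹).x
  (t •> z) <• t⁻¹

/-- The orbit of `μ ∈ J_e^*` under the group of triples `τ = (t, a, b)`, `t ∈ H_e`,
`a, b ∈ N_e = e + J_e`, acting on `J_e^*` by `(ρ_τ^* μ)(x) = μ(ρ_τ⁻¹(x))`, `x ∈ J_e`. Here `t` is
given by a preimage under the surjection `H → H_e`, `h ↦ he`. -/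
def orbit (e : MonoidAlgebra k H) (μ : Module.Dual k J) : Set (Module.Dual k J) :=
  {ν | ν ∈ dualCorner e ∧ ∃ t : H, ∃ a ∈ unipotent (J := J) e, ∃ b ∈ unipotent (J := J) e,
    ∀ x ∈ corner (J := J) e, ν (rho t a b x) = μ x}

/-- `ω` is an orbit in `J_e^*` that is regular with respect to `H_e`: it meets no `J_f^*` with
`f ≠ e` an idempotent of the algebra `e(kH)e = (kH)e`, whose identity is `e`. -/
def IsRegularOrbit (e : MonoidAlgebra k H) (ω : Set (Module.Dual k J)) : Prop :=
  (∃ μ ∈ dualCorner e, ω = orbit e μ) ∧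
    ∀ f : MonoidAlgebra k H, IsIdempotentElem f → f * e = f → f ≠ e → ω ∩ dualCorner f = ∅

/-- The subgroup `G_α = H(e) + J_{μ,right}` of `G`, where `J_{μ,right} = {x : μ(xJ) = 0}`. -/
def stab (e : MonoidAlgebra k H) (μ : Module.Dual k J) (hμ : μ ∈ dualCorner e) :
    Subgroup (TriGroup H J) where
  carrier := {g | g.h ∈ fixer e ∧ ∀ y : J, μ (g.x * y) = 0}
  one_mem' := ⟨one_mem _, by simp [TriGroup.one_x]⟩
  mul_mem' := by
    rintro a b ⟨ha, ha'⟩ ⟨hb, hb'⟩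
    refine ⟨mul_mem ha hb, fun y => ?_⟩
    rw [TriGroup.mul_x, add_mul, add_mul, ← IsTriangularPair.left_mul,
      ← IsTriangularPair.mid_mul, mul_assoc, map_add, map_add,
      apply_smul_of_mem_fixer hμ ha, ha', ha', hb']
    simp
  inv_mem' := by
    rintro g ⟨hg, hg'⟩
    have hh : g.h * (g⁻¹).h = 1 := congrArg TriGroup.h (mul_inv_cancel g)
    have hx : g.h •> (g⁻¹).x + g.x <• (g⁻¹).h + g.x * (g⁻¹).x = 0 :=
      congrArg TriGroup.x (mul_inv_cancel g)
    refine ⟨?_, fun y => ?_⟩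
    · rw [← inv_eq_of_mul_eq_one_right hh]
      exact inv_mem hg
    · have h0 := congrArg (fun z => μ (z * y)) hx
      simp only [add_mul, map_add, zero_mul, map_zero] at h0
      rwa [← IsTriangularPair.left_mul, ← IsTriangularPair.mid_mul, mul_assoc,
        apply_smul_of_mem_fixer hμ hg, hg', hg', add_zero, add_zero] at h0

/-- The linear character `ξ(h + x) = θ(h) ε(μ(x))` of the subgroup `H(e) + J_{μ,right}`. -/
noncomputable def xi (ε : AddChar k ℂ) (e : MonoidAlgebra k H) (μ : Module.Dual k J)
    (hμ : μ ∈ dualCorner e) (θ : fixer e →* ℂˣ) (g : stab e μ hμ) : ℂ :=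
  (θ ⟨g.1.h, g.2.1⟩ : ℂ) * ε (μ g.1.x)

end Orbits

open Classical in
/-- The character of the finite group `G` induced from the function `φ` on the subgroup `K`:
`g ↦ |K|⁻¹ ∑ φ(s⁻¹gs)`, the sum over all `s ∈ G` with `s⁻¹gs ∈ K`. -/
noncomputable def inducedCharacter {G : Type*} [Group G] (K : Subgroup G) (φ : K → ℂ) (g : G) : ℂ :=
  (Nat.card K : ℂ)⁻¹ * ∑ᶠ s : G, if hs : s⁻¹ * g * s ∈ K then φ ⟨s⁻¹ * g * s, hs⟩ else 0

section Supercharacters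

variable {k H J : Type*} [Field k] [CommGroup H] [NonUnitalRing J] [Module k J]
  [DistribMulAction H J] [DistribMulAction Hᵐᵒᵖ J] [SMulCommClass H Hᵐᵒᵖ J]
  [SMulCommClass H k J] [SMulCommClass Hᵐᵒᵖ k J] [IsTriangularPair H J]

/-- A triple `α = (e, θ, ω)`: an idempotent `e ∈ kH`, a linear character `θ` of `H(e)` and an
orbit `ω` in `J_e^*` that is regular with respect to `H_e`. -/
structure Triple (k H J : Type*) [Field k] [CommGroup H] [NonUnitalRing J] [Module k J]
    [DistribMulAction H J] [DistribMulAction Hᵐᵒᵖ J] [SMulCommClass H Hᵐᵒᵖ J]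
    [SMulCommClass H k J] [SMulCommClass Hᵐᵒᵖ k J] [IsTriangularPair H J] where
  e : MonoidAlgebra k H
  idem : IsIdempotentElem e
  θ : fixer e →* ℂˣ
  ω : Set (Module.Dual k J)
  regular : IsRegularOrbit e ω

theorem Triple.mem_dualCorner (α : Triple k H J) {μ : Module.Dual k J} (hμ : μ ∈ α.ω) :
    μ ∈ dualCorner α.e := by
  obtain ⟨⟨ν, _, h⟩, _⟩ := α.regular
  rw [h] at hμ
  exact hμ.1

/-- `χ` is a supercharacter of `G = H + J` (with respect to the fixed additive character `ε`):
`χ = Ind(ξ_{θ,μ}, G_α, G)` for a triple `α = (e, θ, ω)` and some `μ ∈ ω`. -/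
def IsSupercharacter (ε : AddChar k ℂ) (χ : TriGroup H J → ℂ) : Prop :=
  ∃ (α : Triple k H J) (μ : Module.Dual k J) (hμ : μ ∈ α.ω),
    χ = inducedCharacter (stab α.e μ (α.mem_dualCorner hμ))
      (xi ε α.e μ (α.mem_dualCorner hμ) α.θ)

end Supercharacters

end Triangular

/-! The argument combines Mackey's formula with Kirillov-style orbit counting, where G acts on
linear forms by (gμ)(x) = μ(xg).

By Mackey (`indFun_mul_indFun_mem`), the product of two supercharacters is a sum of characters
induced from intersections K = S₁ ∩ bS₂b⁻¹ of the defining subgroups. K meets 1 + J in 1 + I for a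
right ideal I. Since char k does not divide |H|, a cocycle can be averaged, and K is conjugate to a
subgroup A + I' with A ≤ H (`exists_conj_split`). There the product of the two linear characters
again has the form h + x ↦ θ(h)ε(ν(x)).

Fourier inversion on J (`indFun_eq_monomialFun`) turns the character induced from A + I into one
induced from a monomial representation of A + J. Its basis is the set M of all forms that agree with
ν on I. Decomposing M into orbits leaves the characters induced from the stabilizers of forms μ in A
+ J, and μ may be replaced by any point of its orbit.

It remains to recognise such a stabilizer character as a sum of supercharacters
(`exists_move_mem_superCone`). As kH is semisimple, the parts of kH that annihilate μ from the left
and from the right, modulo J, are cut out by idempotents f and f'. Translations by 1 + J make μ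
supported on fJf', and for e = f + f' - ff' its orbit in J_e^* is regular. The stabilizer has H-part
inside H(e), so inducing in stages through the extensions of θ to H(e) gives a sum of characters
induced from H(e) + J_{μ,left}. These are supercharacters because the left and right annihilators of
μ induce the same character (`IsFormPair.indFun_eq`). That is the Fourier argument once more, now
with M a single orbit. -/

set_option linter.unusedSectionVars false

/-! ### Induced class functions on a finite group. -/

section InducedFunctions

open Classical in
/-- The function on `G` induced from the restriction to the subgroup `K` of `F : G → ℂ`. -/
noncomputable def indFun {G : Type*} [Group G] [Fintype G] (K : Subgroup G) (F : G → ℂ) (g : G) :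
    ℂ :=
  (Nat.card K : ℂ)⁻¹ * ∑ s : G, if s⁻¹ * g * s ∈ K then F (s⁻¹ * g * s) else 0

variable {G : Type*} [Group G] [Fintype G]

/-- Working with functions on all of G frees conjugation and change of subgroup from membership
proofs. -/
theorem inducedCharacter_eq_indFun (K : Subgroup G) (φ : K → ℂ) (F : G → ℂ)
    (h : ∀ g : K, φ g = F g) : Triangular.inducedCharacter K φ = indFun K F := by
  funext g
  rw [Triangular.inducedCharacter, indFun, finsum_eq_sum_of_fintype]
  congr 1
  refine Finset.sum_congr rfl fun s _ => ?_
  split_ifs with hs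
  · exact h _
  · rfl

theorem indFun_congr {K K' : Subgroup G} {F F' : G → ℂ} (hK : K = K')
    (hF : ∀ g ∈ K, F g = F' g) : indFun K F = indFun K' F' := by
  subst hK
  funext g
  rw [indFun, indFun]
  congr 1
  refine Finset.sum_congr rfl fun s _ => ?_
  split_ifs with hs
  · exact hF _ hs
  · rfl

theorem sum_conj_mul_right (P : G → ℂ) (a g : G) :
    ∑ s : G, P (a * (s⁻¹ * g * s) * a⁻¹) = ∑ s : G, P (s⁻¹ * g * s) := by
  refine Fintype.sum_equiv (Equiv.mulRight a⁻¹) _ _ fun s => ?_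
  simp [mul_assoc]

theorem indFun_conj_arg (K : Subgroup G) (F : G → ℂ) (a g : G) :
    indFun K F (a⁻¹ * g * a) = indFun K F g := by
  classical
  rw [indFun, indFun]
  congr 1
  refine Fintype.sum_equiv (Equiv.mulLeft a) _ _ fun s => ?_
  simp [mul_assoc]

theorem indFun_conj (K K' : Subgroup G) (F : G → ℂ) (u : G) (h : ∀ g, g ∈ K' ↔ u * g * u⁻¹ ∈ K) :
    indFun K' (fun g => F (u * g * u⁻¹)) = indFun K F := by
  classical
  have hcard : Nat.card K' = Nat.card K := by
    refine Nat.card_congr ((MulAut.conj u).toEquiv.subtypeEquiv fun g => ?_)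
    simpa using h g
  funext g
  rw [indFun, indFun, hcard]
  congr 1
  rw [← sum_conj_mul_right (fun y => if y ∈ K then F y else 0) u g]
  simp only [h]

/-! ### Monomial characters and their decomposition into orbits. -/

section Orbits

variable {X : Type*} [MulAction G X]

theorem card_orbit_mul_card_inf_stabilizer (G₀ : Subgroup G) (x : X) :
    Nat.card (MulAction.orbit G₀ x) * Nat.card (G₀ ⊓ MulAction.stabilizer G x : Subgroup G) =
      Nat.card G₀ := by
  have e : (G₀ ⊓ MulAction.stabilizer G x : Subgroup G) ≃ MulAction.stabilizer G₀ x :=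
    { toFun := fun g => ⟨⟨g.1, g.2.1⟩, g.2.2⟩
      invFun := fun g => ⟨g.1.1, g.1.2, g.2⟩
      left_inv := fun _ => rfl
      right_inv := fun _ => rfl }
  rw [Nat.card_congr e, ← Nat.card_prod]
  exact Nat.card_congr (MulAction.orbitProdStabilizerEquivGroup G₀ x)

open Classical in
/-- The character, induced from `G₀` to `G`, of the monomial representation of `G₀` with basis
`M` and coefficients `F`. -/
noncomputable def monomialFun (G₀ : Subgroup G) (M : Finset X) (F : X → G → ℂ) (g : G) : ℂ :=
  (Nat.card G₀ : ℂ)⁻¹ * ∑ s : G, ∑ x ∈ M,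
    if s⁻¹ * g * s ∈ G₀ ∧ (s⁻¹ * g * s) • x = x then F x (s⁻¹ * g * s) else 0

variable {G₀ : Subgroup G} {F : X → G → ℂ}

/-- A transitive monomial representation is induced from a point stabilizer. The hypothesis `hF`
says that the coefficients are equivariant, so all points contribute equally, and orbit-stabilizer
fixes the constant. -/
theorem monomialFun_orbit (M : Finset X) (x₀ : X) (hM : ∀ x, x ∈ M ↔ x ∈ MulAction.orbit G₀ x₀)
    (hF : ∀ a ∈ G₀, ∀ x ∈ M, ∀ g ∈ G₀, g • x = x → F (a • x) (a * g * a⁻¹) = F x g) :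
    monomialFun G₀ M F = indFun (G₀ ⊓ MulAction.stabilizer G x₀) (F x₀) := by
  classical
  funext g
  rw [monomialFun, indFun, Finset.sum_comm]
  have hx₀ : x₀ ∈ M := (hM _).2 (MulAction.mem_orbit_self _)
  have key : ∀ x ∈ M, (∑ s : G, if s⁻¹ * g * s ∈ G₀ ∧ (s⁻¹ * g * s) • x = x then
      F x (s⁻¹ * g * s) else 0) = ∑ s : G,
      if s⁻¹ * g * s ∈ G₀ ⊓ MulAction.stabilizer G x₀ then F x₀ (s⁻¹ * g * s) else 0 := by
    intro x hx
    obtain ⟨⟨a, ha⟩, rfl⟩ := (hM x).1 hx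
    change (∑ s : G, if s⁻¹ * g * s ∈ G₀ ∧ (s⁻¹ * g * s) • a • x₀ = a • x₀ then
      F (a • x₀) (s⁻¹ * g * s) else 0) = _
    -- Reindexing the sum over s by right translation with a carries the term of a • x₀ to that of
    -- x₀.
    rw [← sum_conj_mul_right (fun y => if y ∈ G₀ ∧ y • a • x₀ = a • x₀ then
      F (a • x₀) y else 0) a g]
    refine Finset.sum_congr rfl fun s _ => ?_
    generalize s⁻¹ * g * s = y
    have h1 : a * y * a⁻¹ ∈ G₀ ↔ y ∈ G₀ := by
      rw [Subgroup.mul_mem_cancel_right _ (inv_mem ha), Subgroup.mul_mem_cancel_left _ ha]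
    have h2 : (a * y * a⁻¹) • a • x₀ = a • x₀ ↔ y • x₀ = x₀ := by
      rw [mul_smul, mul_smul, inv_smul_smul, smul_left_cancel_iff]
    simp only [h1, h2, Subgroup.mem_inf, MulAction.mem_stabilizer_iff]
    split_ifs with h
    · exact hF a ha x₀ hx₀ y h.1 h.2
    · rfl
  rw [Finset.sum_congr rfl key, Finset.sum_const, nsmul_eq_mul, ← mul_assoc]
  congr 1
  have hc : M.card = Nat.card (MulAction.orbit G₀ x₀) := by
    rw [← Nat.card_eq_finsetCard M]
    exact Nat.card_congr (Equiv.subtypeEquivRight hM)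
  rw [hc, ← card_orbit_mul_card_inf_stabilizer G₀ x₀]
  have h1 : (Nat.card (MulAction.orbit G₀ x₀) : ℂ) ≠ 0 := by
    rw [← hc]; exact_mod_cast (Finset.card_pos.2 ⟨_, hx₀⟩).ne'
  have h2 : (Nat.card (G₀ ⊓ MulAction.stabilizer G x₀ : Subgroup G) : ℂ) ≠ 0 :=
    Nat.cast_ne_zero.2 Nat.card_pos.ne'
  push_cast
  field_simp

/-- Splitting off one orbit at a time reduces membership to transitive pieces. In each orbit only
one conveniently chosen representative has to be examined. -/
theorem monomialFun_mem (C : AddSubmonoid (G → ℂ)) (M : Finset X)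
    (hM : ∀ a ∈ G₀, ∀ x ∈ M, a • x ∈ M)
    (hF : ∀ a ∈ G₀, ∀ x ∈ M, ∀ g ∈ G₀, g • x = x → F (a • x) (a * g * a⁻¹) = F x g)
    (hC : ∀ x ∈ M, ∃ a ∈ G₀, indFun (G₀ ⊓ MulAction.stabilizer G (a • x)) (F (a • x)) ∈ C) :
    monomialFun G₀ M F ∈ C := by
  classical
  induction M using Finset.strongInduction with
  | H M ih =>
    rcases M.eq_empty_or_nonempty with rfl | ⟨x, hx⟩
    · convert C.zero_mem
      funext g
      simp [monomialFun]
    · obtain ⟨a, ha, hax⟩ := hC x hx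
      have hsub : ∀ y, y ∈ MulAction.orbit G₀ x → y ∈ M := by
        rintro _ ⟨⟨b, hb⟩, rfl⟩
        exact hM b hb x hx
      set M₁ := M.filter (fun y => y ∈ MulAction.orbit G₀ x) with hM₁
      set M₂ := M.filter (fun y => y ∉ MulAction.orbit G₀ x) with hM₂
      have horb : MulAction.orbit G₀ (a • x) = MulAction.orbit G₀ x :=
        MulAction.orbit_eq_iff.2 ⟨⟨a, ha⟩, rfl⟩
      have h1 : monomialFun G₀ M₁ F ∈ C := by
        rw [monomialFun_orbit M₁ (a • x)]
        · exact hax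
        · intro y
          rw [horb, hM₁, Finset.mem_filter]
          exact ⟨fun h => h.2, fun h => ⟨hsub y h, h⟩⟩
        · exact fun b hb y hy => hF b hb y (Finset.mem_of_mem_filter _ hy)
      have h2 : monomialFun G₀ M₂ F ∈ C := by
        refine ih M₂ (Finset.filter_ssubset.2 ⟨x, hx, not_not.2 (MulAction.mem_orbit_self _)⟩)
          ?_ ?_ ?_
        · intro b hb y hy
          rw [hM₂, Finset.mem_filter] at hy ⊢
          refine ⟨hM b hb y hy.1, fun h => hy.2 ?_⟩
          rw [← MulAction.orbit_eq_iff] at h ⊢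
          rw [← h]
          exact (MulAction.orbit_eq_iff.2 ⟨(⟨b, hb⟩ : G₀), rfl⟩).symm
        · exact fun b hb y hy => hF b hb y (Finset.mem_of_mem_filter _ hy)
        · exact fun y hy => hC y (Finset.mem_of_mem_filter _ hy)
      convert C.add_mem h1 h2 using 1
      funext g
      simp only [monomialFun, Pi.add_apply]
      rw [← mul_add, ← Finset.sum_add_distrib]
      congr 1
      refine Finset.sum_congr rfl fun s _ => ?_
      rw [hM₁, hM₂, Finset.sum_filter_add_sum_filter_not]

end Orbits

/-! ### Coset sums and Mackey's product formula. -/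

theorem sum_quotient_out_mul (S : Subgroup G) [Fintype S] [Fintype (G ⧸ S)] (P : G → ℂ) :
    ∑ s : G, P s = ∑ x : G ⧸ S, ∑ t : S, P (x.out * t) := by
  rw [← Fintype.sum_prod_type' (f := fun (x : G ⧸ S) (t : S) => P (x.out * t))]
  symm
  refine Fintype.sum_bijective (fun p : (G ⧸ S) × S => p.1.out * (p.2 : G)) ⟨?_, ?_⟩ _ _
    fun _ => rfl
  · rintro ⟨x, t⟩ ⟨x', t'⟩ h
    have hx : x = x' := by
      have := congrArg (QuotientGroup.mk (s := S)) h
      simpa using this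
    subst hx
    simpa using h
  · intro s
    refine ⟨(QuotientGroup.mk s, ⟨(QuotientGroup.mk s : G ⧸ S).out⁻¹ * s, ?_⟩), by simp⟩
    rw [← QuotientGroup.eq, QuotientGroup.out_eq']

theorem smul_eq_self_iff_out (S : Subgroup G) (g : G) (x : G ⧸ S) :
    g • x = x ↔ x.out⁻¹ * g * x.out ∈ S := by
  conv_lhs => rw [← QuotientGroup.out_eq' x]
  rw [eq_comm, MulAction.Quotient.smul_mk, QuotientGroup.eq, smul_eq_mul, mul_assoc]

theorem indFun_eq_sum_quotient (S : Subgroup G) (F : G → ℂ)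
    (hF : ∀ a ∈ S, ∀ g ∈ S, F (a * g * a⁻¹) = F g) [Fintype (G ⧸ S)] [DecidableEq (G ⧸ S)] (g : G) :
    indFun S F g = ∑ x : G ⧸ S, if g • x = x then F (x.out⁻¹ * g * x.out) else 0 := by
  classical
  rw [indFun, sum_quotient_out_mul S, Finset.mul_sum]
  refine Finset.sum_congr rfl fun x _ => ?_
  simp only [smul_eq_self_iff_out]
  have key : ∀ t : S, (if (x.out * (t : G))⁻¹ * g * (x.out * t) ∈ S then
      F ((x.out * (t : G))⁻¹ * g * (x.out * t)) else 0) =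
      if x.out⁻¹ * g * x.out ∈ S then F (x.out⁻¹ * g * x.out) else 0 := by
    intro t
    have e : (x.out * (t : G))⁻¹ * g * (x.out * t) =
        (t : G)⁻¹ * (x.out⁻¹ * g * x.out) * (t : G)⁻¹⁻¹ := by group
    have h1 : (t : G)⁻¹ * (x.out⁻¹ * g * x.out) * (t : G)⁻¹⁻¹ ∈ S ↔ x.out⁻¹ * g * x.out ∈ S := by
      rw [Subgroup.mul_mem_cancel_right _ (inv_mem (inv_mem t.2)),
        Subgroup.mul_mem_cancel_left _ (inv_mem t.2)]
    rw [e]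
    simp only [h1]
    split_ifs with h
    · exact hF _ (inv_mem t.2) _ h
    · rfl
  rw [Finset.sum_congr rfl fun t _ => key t, Finset.sum_const, nsmul_eq_mul, Finset.card_univ,
    ← Nat.card_eq_fintype_card, ← mul_assoc, inv_mul_cancel₀, one_mul]
  exact Nat.cast_ne_zero.2 Nat.card_pos.ne'

/-- Mackey's formula for a product of two induced functions: if every summand lies in the
additive submonoid `C`, so does the product. -/
theorem indFun_mul_indFun_mem (C : AddSubmonoid (G → ℂ)) (S₁ S₂ : Subgroup G) (F₁ F₂ : G → ℂ)
    (h₁ : ∀ a ∈ S₁, ∀ g ∈ S₁, F₁ (a * g * a⁻¹) = F₁ g)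
    (h₂ : ∀ a ∈ S₂, ∀ g ∈ S₂, F₂ (a * g * a⁻¹) = F₂ g)
    (hC : ∀ (b : G) (K : Subgroup G), (∀ g, g ∈ K ↔ g ∈ S₁ ∧ b⁻¹ * g * b ∈ S₂) →
      indFun K (fun g => F₁ g * F₂ (b⁻¹ * g * b)) ∈ C) :
    (fun g => indFun S₁ F₁ g * indFun S₂ F₂ g) ∈ C := by
  classical
  -- Ind F₁ · Ind F₂ is induced from F₁ times the restriction of Ind F₂ to S₁. That restriction is
  -- monomial on the cosets of S₂, and its S₁-orbits are the double cosets.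
  have key : (fun g => indFun S₁ F₁ g * indFun S₂ F₂ g) = monomialFun S₁
      (Finset.univ : Finset (G ⧸ S₂)) (fun x g => F₁ g * F₂ (x.out⁻¹ * g * x.out)) := by
    funext g
    rw [monomialFun, indFun, mul_assoc, Finset.sum_mul]
    congr 1
    refine Finset.sum_congr rfl fun s _ => ?_
    rw [← indFun_conj_arg S₂ F₂ s g, indFun_eq_sum_quotient S₂ F₂ h₂, Finset.mul_sum]
    refine Finset.sum_congr rfl fun x _ => ?_
    by_cases hs : s⁻¹ * g * s ∈ S₁ <;> by_cases hx : (s⁻¹ * g * s) • x = x <;> simp [hs, hx]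
  rw [key]
  refine monomialFun_mem C _ (fun _ _ _ _ => Finset.mem_univ _) ?_ fun x _ => ⟨1, one_mem _, ?_⟩
  · intro a ha x _ g hg hgx
    rw [h₁ a ha g hg]
    congr 1
    -- The chosen representatives of x and a • x differ by this element of S₂, under whose
    -- conjugation F₂ is invariant.
    set t := (a • x).out⁻¹ * a * x.out with ht
    have htS : t ∈ S₂ := by
      rw [ht, mul_assoc, ← QuotientGroup.eq, QuotientGroup.out_eq', ← smul_eq_mul,
        ← MulAction.Quotient.smul_mk, QuotientGroup.out_eq']
    rw [← h₂ t htS _ ((smul_eq_self_iff_out S₂ g x).1 hgx), ht]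
    congr 1
    group
  · rw [one_smul]
    refine hC x.out _ fun g => ?_
    rw [Subgroup.mem_inf, MulAction.mem_stabilizer_iff, smul_eq_self_iff_out]

end InducedFunctions
namespace Triangular

/-! ### Left and right multiplication by G on J. -/

section Operators

variable {H J : Type*} [CommGroup H] [NonUnitalRing J]
  [DistribMulAction H J] [DistribMulAction Hᵐᵒᵖ J] [SMulCommClass H Hᵐᵒᵖ J]
  [IsTriangularPair H J]

/-- Multiplication `x ↦ g x` by an element `g` of `G = H + J` on `J`. -/
def lact (g : TriGroup H J) : J →+ J where
  toFun x := g.h •> x + g.x * x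
  map_zero' := by simp
  map_add' x y := by rw [smul_add, mul_add]; abel

/-- Multiplication `x ↦ x g` by an element `g` of `G = H + J` on `J`. -/
def ract (g : TriGroup H J) : J →+ J where
  toFun x := x <• g.h + x * g.x
  map_zero' := by simp
  map_add' x y := by rw [smul_add, add_mul]; abel

theorem lact_apply (g : TriGroup H J) (x : J) : lact g x = g.h •> x + g.x * x := rfl

theorem ract_apply (g : TriGroup H J) (x : J) : ract g x = x <• g.h + x * g.x := rfl

theorem mul_x_eq_lact (g g' : TriGroup H J) : (g * g').x = lact g g'.x + g.x <• g'.h := by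
  rw [TriGroup.mul_x, lact_apply]; abel

theorem mul_x_eq_ract (g g' : TriGroup H J) : (g * g').x = ract g' g.x + g.h •> g'.x := by
  rw [TriGroup.mul_x, ract_apply]; abel

@[simp] theorem lact_one (x : J) : lact (1 : TriGroup H J) x = x := by
  simp [lact_apply, TriGroup.one_h, TriGroup.one_x]

@[simp] theorem ract_one (x : J) : ract (1 : TriGroup H J) x = x := by
  simp [ract_apply, TriGroup.one_h, TriGroup.one_x]

theorem lact_mul (g g' : TriGroup H J) (x : J) : lact (g * g') x = lact g (lact g' x) := by
  simp only [lact_apply, TriGroup.mul_h, TriGroup.mul_x, smul_add, add_mul, mul_add, mul_smul,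
    IsTriangularPair.left_mul, IsTriangularPair.mid_mul, mul_assoc]
  abel

theorem ract_mul (g g' : TriGroup H J) (x : J) : ract (g * g') x = ract g' (ract g x) := by
  simp only [ract_apply, TriGroup.mul_h, TriGroup.mul_x, smul_add, add_mul, mul_add, mul_smul,
    MulOpposite.op_mul, IsTriangularPair.right_mul, IsTriangularPair.mid_mul, mul_assoc]
  abel

@[simp] theorem lact_inv_lact (g : TriGroup H J) (x : J) : lact g⁻¹ (lact g x) = x := by
  rw [← lact_mul, inv_mul_cancel, lact_one]

@[simp] theorem lact_lact_inv (g : TriGroup H J) (x : J) : lact g (lact g⁻¹ x) = x := by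
  rw [← lact_mul, mul_inv_cancel, lact_one]

@[simp] theorem ract_inv_ract (g : TriGroup H J) (x : J) : ract g⁻¹ (ract g x) = x := by
  rw [← ract_mul, mul_inv_cancel, ract_one]

@[simp] theorem ract_ract_inv (g : TriGroup H J) (x : J) : ract g (ract g⁻¹ x) = x := by
  rw [← ract_mul, inv_mul_cancel, ract_one]

theorem lact_ract (g g' : TriGroup H J) (x : J) : lact g (ract g' x) = ract g' (lact g x) := by
  simp only [lact_apply, ract_apply, smul_add, add_mul, mul_add, IsTriangularPair.left_mul,
    IsTriangularPair.right_mul, mul_assoc, smul_comm g.h (MulOpposite.op g'.h) x]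
  abel

theorem lact_mul_apply (g : TriGroup H J) (x y : J) : lact g (x * y) = lact g x * y := by
  simp only [lact_apply, IsTriangularPair.left_mul, add_mul, mul_assoc]

theorem ract_mul_apply (g : TriGroup H J) (x y : J) : ract g (x * y) = x * ract g y := by
  simp only [ract_apply, IsTriangularPair.right_mul, mul_add, mul_assoc]

theorem ract_apply_mul (g : TriGroup H J) (x y : J) : ract g x * y = x * lact g y := by
  simp only [ract_apply, lact_apply, IsTriangularPair.mid_mul, mul_add, add_mul, mul_assoc]

/-- The automorphism `x ↦ a⁻¹ x a` of `J`. -/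
noncomputable def cj (a : TriGroup H J) : J →+ J := (lact a⁻¹).comp (ract a)

theorem cj_apply (a : TriGroup H J) (x : J) : cj a x = lact a⁻¹ (ract a x) := rfl

theorem cj_mul (a : TriGroup H J) (x y : J) : cj a (x * y) = cj a x * cj a y := by
  rw [cj_apply, cj_apply, cj_apply, ract_mul_apply, lact_mul_apply, lact_ract, ract_apply_mul,
    lact_lact_inv]

theorem cj_lact (a g : TriGroup H J) (x : J) :
    cj a (lact g x) = lact (a⁻¹ * g * a) (cj a x) := by
  simp only [cj_apply, lact_mul, lact_lact_inv, lact_ract]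

theorem cj_ract (a g : TriGroup H J) (x : J) :
    cj a (ract g x) = ract (a⁻¹ * g * a) (cj a x) := by
  simp only [cj_apply, ract_mul, ← lact_ract, ract_inv_ract]

theorem h_mul (g g' : TriGroup H J) : (g * g').h = g.h * g'.h := rfl

theorem h_one : (1 : TriGroup H J).h = 1 := rfl

/-- The projection `G → H`. -/
def projH : TriGroup H J →* H where
  toFun g := g.h
  map_one' := rfl
  map_mul' _ _ := rfl

theorem h_inv (g : TriGroup H J) : (g⁻¹).h = g.h⁻¹ := map_inv projH g

theorem h_conj (a g : TriGroup H J) : (a⁻¹ * g * a).h = g.h := by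
  rw [h_mul, h_mul, h_inv, mul_comm, mul_inv_cancel_left]

theorem lact_one_add (x y : J) : lact (⟨1, x⟩ : TriGroup H J) y = y + x * y := by
  simp [lact_apply]

theorem ract_one_add (x y : J) : ract (⟨1, x⟩ : TriGroup H J) y = y + y * x := by
  simp [ract_apply]

theorem conj_one_add (a : TriGroup H J) (x : J) :
    a⁻¹ * ⟨1, x⟩ * a = (⟨1, cj a x⟩ : TriGroup H J) := by
  rw [mul_assoc, inv_mul_eq_iff_eq_mul]
  ext
  · simp [h_mul]
  · rw [mul_x_eq_lact, mul_x_eq_lact, cj_apply, lact_lact_inv, ract_apply, lact_one_add]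
    simp only [MulOpposite.op_one, one_smul]
    abel

theorem mul_inv_of_h_eq {g g' : TriGroup H J} (h : g.h = g'.h) :
    g * g'⁻¹ = ⟨1, ract g'⁻¹ (g.x - g'.x)⟩ := by
  rw [mul_inv_eq_iff_eq_mul]
  ext
  · simp [h_mul, h]
  · rw [mul_x_eq_ract, ract_ract_inv]; simp

theorem of_mul_one_add (h : H) (x : J) :
    (⟨h, 0⟩ * ⟨1, x⟩ : TriGroup H J) = ⟨h, h •> x⟩ := by
  ext
  · simp [h_mul]
  · simp [mul_x_eq_lact, lact_apply]

/-- The projection of `G = H + J` onto its components. -/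
def equivProd (H J : Type*) : TriGroup H J ≃ H × J where
  toFun g := (g.h, g.x)
  invFun p := ⟨p.1, p.2⟩
  left_inv _ := rfl
  right_inv _ := rfl

theorem finite_triGroup (H J : Type*) [Finite H] [Finite J] : Finite (TriGroup H J) :=
  Finite.of_equiv _ (equivProd H J).symm

theorem card_of_mem_iff {S : Type*} [SetLike S J] (K : Subgroup (TriGroup H J)) (A : Subgroup H)
    (I : S) (hK : ∀ g, g ∈ K ↔ g.h ∈ A ∧ g.x ∈ I) :
    Nat.card K = Nat.card A * Nat.card I := by
  rw [← Nat.card_prod]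
  exact Nat.card_congr
    { toFun := fun g => (⟨g.1.h, ((hK _).1 g.2).1⟩, ⟨g.1.x, ((hK _).1 g.2).2⟩)
      invFun := fun p => ⟨⟨p.1, p.2⟩, (hK _).2 ⟨p.1.2, p.2.2⟩⟩
      left_inv := fun _ => rfl
      right_inv := fun _ => rfl }

end Operators

/-! ### Linear forms as a G-set, and the two actions of kH. -/

section GroupAlgebra

variable {k H J : Type*} [Field k] [CommGroup H] [NonUnitalRing J] [Module k J]
  [IsScalarTower k J J] [SMulCommClass k J J]
  [DistribMulAction H J] [DistribMulAction Hᵐᵒᵖ J] [SMulCommClass H Hᵐᵒᵖ J]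
  [SMulCommClass H k J] [SMulCommClass Hᵐᵒᵖ k J] [IsTriangularPair H J]

theorem lact_smul (g : TriGroup H J) (c : k) (x : J) : lact g (c • x) = c • lact g x := by
  rw [lact_apply, lact_apply, smul_add, smul_comm g.h c x, mul_smul_comm]

theorem ract_smul (g : TriGroup H J) (c : k) (x : J) : ract g (c • x) = c • ract g x := by
  rw [ract_apply, ract_apply, smul_add, smul_comm (MulOpposite.op g.h) c x, smul_mul_assoc]

/-- `x ↦ g x` as a linear map. -/
def lactₗ (k : Type*) {H J : Type*} [Field k] [CommGroup H] [NonUnitalRing J] [Module k J]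
    [IsScalarTower k J J] [SMulCommClass k J J]
    [DistribMulAction H J] [DistribMulAction Hᵐᵒᵖ J] [SMulCommClass H Hᵐᵒᵖ J]
    [SMulCommClass H k J] [SMulCommClass Hᵐᵒᵖ k J] [IsTriangularPair H J]
    (g : TriGroup H J) : J →ₗ[k] J :=
  { lact g with map_smul' := fun c x => lact_smul g c x }

/-- `x ↦ x g` as a linear map. -/
def ractₗ (k : Type*) {H J : Type*} [Field k] [CommGroup H] [NonUnitalRing J] [Module k J]
    [IsScalarTower k J J] [SMulCommClass k J J]
    [DistribMulAction H J] [DistribMulAction Hᵐᵒᵖ J] [SMulCommClass H Hᵐᵒᵖ J]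
    [SMulCommClass H k J] [SMulCommClass Hᵐᵒᵖ k J] [IsTriangularPair H J]
    (g : TriGroup H J) : J →ₗ[k] J :=
  { ract g with map_smul' := fun c x => ract_smul g c x }

@[simp] theorem lactₗ_apply (g : TriGroup H J) (x : J) : lactₗ k g x = lact g x := rfl

@[simp] theorem ractₗ_apply (g : TriGroup H J) (x : J) : ractₗ k g x = ract g x := rfl

/-- `G` acts on the linear forms on `J` by `(g μ)(x) = μ(xg)`. -/
noncomputable instance dualMulAction : MulAction (TriGroup H J) (Module.Dual k J) where
  smul g μ := μ ∘ₗ ractₗ k g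
  one_smul μ := by
    ext x
    change μ (ract 1 x) = μ x
    rw [ract_one]
  mul_smul g g' μ := by
    ext x
    change μ (ract (g * g') x) = μ (ract g' (ract g x))
    rw [ract_mul]

theorem smul_dual_apply (g : TriGroup H J) (μ : Module.Dual k J) (x : J) :
    (g • μ) x = μ (ract g x) := rfl

theorem smul_dual_eq_iff (g : TriGroup H J) (μ : Module.Dual k J) :
    g • μ = μ ↔ ∀ x, μ (ract g x) = μ x := LinearMap.ext_iff

theorem lmul_of (h : H) (x : J) : lmul (MonoidAlgebra.of k H h) x = h •> x := by
  simp [lmul, leftHom]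

theorem rmul_of (h : H) (x : J) : rmul (MonoidAlgebra.of k H h) x = x <• h := by
  simp [rmul, rightHom]

theorem lmul_mul (a : MonoidAlgebra k H) (x y : J) : lmul a (x * y) = lmul a x * y := by
  induction a using MonoidAlgebra.induction_on with
  | of h => rw [lmul_of, lmul_of, IsTriangularPair.left_mul]
  | add a b ha hb => simp only [map_add, LinearMap.add_apply, ha, hb, add_mul]
  | smul c a ha => simp only [map_smul, LinearMap.smul_apply, ha, smul_mul_assoc]

theorem rmul_mul (a : MonoidAlgebra k H) (x y : J) : rmul a (x * y) = x * rmul a y := by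
  induction a using MonoidAlgebra.induction_on with
  | of h => rw [rmul_of, rmul_of, IsTriangularPair.right_mul]
  | add a b ha hb => simp only [map_add, LinearMap.add_apply, ha, hb, mul_add]
  | smul c a ha => simp only [map_smul, LinearMap.smul_apply, ha, mul_smul_comm]

theorem rmul_apply_mul (a : MonoidAlgebra k H) (x y : J) : rmul a x * y = x * lmul a y := by
  induction a using MonoidAlgebra.induction_on with
  | of h => rw [lmul_of, rmul_of, IsTriangularPair.mid_mul]
  | add a b ha hb => simp only [map_add, LinearMap.add_apply, ha, hb, mul_add, add_mul]
  | smul c a ha => simp only [map_smul, LinearMap.smul_apply, ha, smul_mul_assoc, mul_smul_comm]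

theorem lmul_smul_right (a : MonoidAlgebra k H) (h : H) (x : J) :
    lmul a (x <• h) = lmul a x <• h := by
  induction a using MonoidAlgebra.induction_on with
  | of h' => rw [lmul_of, lmul_of, smul_comm]
  | add a b ha hb => simp only [map_add, LinearMap.add_apply, ha, hb, smul_add]
  | smul c a ha =>
    simp only [map_smul, LinearMap.smul_apply, ha]
    exact (smul_comm _ _ _).symm

theorem rmul_smul_left (a : MonoidAlgebra k H) (h : H) (x : J) :
    rmul a (h •> x) = h •> rmul a x := by
  induction a using MonoidAlgebra.induction_on with
  | of h' => rw [rmul_of, rmul_of, smul_comm h]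
  | add a b ha hb => simp only [map_add, LinearMap.add_apply, ha, hb, smul_add]
  | smul c a ha =>
    simp only [map_smul, LinearMap.smul_apply, ha]
    exact (smul_comm _ _ _).symm

theorem lmul_comm (a b : MonoidAlgebra k H) (x : J) :
    lmul a (lmul b x) = lmul b (lmul a x) := by
  rw [← Module.End.mul_apply, ← map_mul, mul_comm, map_mul, Module.End.mul_apply]

theorem rmul_comm (a b : MonoidAlgebra k H) (x : J) :
    rmul a (rmul b x) = rmul b (rmul a x) := by
  rw [← Module.End.mul_apply, ← map_mul, mul_comm, map_mul, Module.End.mul_apply]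

theorem lmul_rmul (a b : MonoidAlgebra k H) (x : J) :
    lmul a (rmul b x) = rmul b (lmul a x) := by
  induction b using MonoidAlgebra.induction_on with
  | of h => rw [rmul_of, rmul_of, lmul_smul_right]
  | add b c hb hc => simp only [map_add, LinearMap.add_apply, hb, hc]
  | smul c b hb => simp only [map_smul, LinearMap.smul_apply, hb]

theorem lact_rmul (g : TriGroup H J) (a : MonoidAlgebra k H) (x : J) :
    lact g (rmul a x) = rmul a (lact g x) := by
  simp only [lact_apply, map_add, rmul_mul, rmul_smul_left]

theorem ract_lmul (g : TriGroup H J) (a : MonoidAlgebra k H) (x : J) :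
    ract g (lmul a x) = lmul a (ract g x) := by
  simp only [ract_apply, map_add, lmul_mul, lmul_smul_right]

end GroupAlgebra

end Triangular
namespace Triangular

/-! ### Fourier analysis on the additive group of J. -/

section Fourier

variable {k J : Type*} [Field k] [AddCommGroup J] [Module k J] {ε : AddChar k ℂ}

theorem exists_apply_ne_one (hε : ε ≠ 1) {μ : Module.Dual k J} {x : J} (hx : μ x ≠ 0) :
    ∃ c : k, ε (c * μ x) ≠ 1 := by
  obtain ⟨c, hc⟩ := (AddChar.ne_one_iff).1 hε
  exact ⟨c / μ x, by rwa [div_mul_cancel₀ _ hx]⟩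

open Classical in
theorem sum_dual_apply [Fintype J] (hε : ε ≠ 1) (μ : Module.Dual k J) :
    ∑ w : J, ε (μ w) = if μ = 0 then (Nat.card J : ℂ) else 0 := by
  split_ifs with h
  · simp [h]
  · obtain ⟨x, hx⟩ : ∃ x, μ x ≠ 0 := by
      by_contra! hc
      exact h (LinearMap.ext hc)
    obtain ⟨c, hc⟩ := exists_apply_ne_one hε hx
    have hψ : ε.compAddMonoidHom μ.toAddMonoidHom ≠ 0 := by
      intro h0
      apply hc
      have := DFunLike.congr_fun h0 (c • x)
      simpa using this
    have := AddChar.sum_eq_zero_iff_ne_zero.2 hψ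
    simpa using this

open Classical in
-- M is a coset of the annihilator of I. If x ∉ I, some φ vanishing on I has φ(x) ≠ 0, and
-- translating M by a multiple of φ multiplies the sum by a scalar different from 1.
theorem sum_coset_annihilator (hε : ε ≠ 1) (I : Submodule k J) (ν : Module.Dual k J)
    (M : Finset (Module.Dual k J)) (hM : ∀ μ, μ ∈ M ↔ ∀ i ∈ I, μ i = ν i) (x : J) :
    ∑ μ ∈ M, ε (μ x) = if x ∈ I then M.card * ε (ν x) else 0 := by
  split_ifs with h
  · rw [Finset.sum_congr rfl fun μ hμ => by rw [(hM μ).1 hμ x h], Finset.sum_const, nsmul_eq_mul]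
  · obtain ⟨φ, hφ, hφI⟩ := Submodule.exists_dual_map_eq_bot_of_notMem h inferInstance
    have hφI' : ∀ i ∈ I, φ i = 0 := fun i hi => by
      have : φ i ∈ I.map φ := Submodule.mem_map_of_mem hi
      rwa [hφI, Submodule.mem_bot] at this
    obtain ⟨c, hc⟩ := exists_apply_ne_one hε hφ
    have key : ∑ μ ∈ M, ε (μ x) = ε (c * φ x) * ∑ μ ∈ M, ε (μ x) := by
      rw [Finset.mul_sum]
      refine Finset.sum_nbij' (fun μ => μ - c • φ) (fun μ => μ + c • φ) ?_ ?_ ?_ ?_ ?_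
      · intro μ hμ
        rw [hM] at hμ ⊢
        intro i hi
        simp [hμ i hi, hφI' i hi]
      · intro μ hμ
        rw [hM] at hμ ⊢
        intro i hi
        simp [hμ i hi, hφI' i hi]
      · simp
      · simp
      · intro μ _
        rw [← AddChar.map_add_eq_mul]
        simp
    have h2 : (1 - ε (c * φ x)) * ∑ μ ∈ M, ε (μ x) = 0 := by linear_combination key
    exact (mul_eq_zero.1 h2).resolve_left (sub_ne_zero.2 hc.symm)

/-- Double counting of ∑ ε((μ - ν)(x)) over M × J: summing over μ first leaves the x in I, summing
over x first leaves μ = ν. -/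
theorem card_coset_annihilator [Finite J] (hε : ε ≠ 1) (I : Submodule k J)
    (ν : Module.Dual k J) (M : Finset (Module.Dual k J))
    (hM : ∀ μ, μ ∈ M ↔ ∀ i ∈ I, μ i = ν i) : (M.card : ℂ) * Nat.card I = Nat.card J := by
  classical
  have := Fintype.ofFinite J
  have h1 : ∑ x : J, ∑ μ ∈ M, ε ((μ - ν) x) = M.card * Nat.card I := by
    have : ∀ x : J, ∑ μ ∈ M, ε ((μ - ν) x) = if x ∈ I then (M.card : ℂ) else 0 := by
      intro x
      have h := sum_coset_annihilator hε I ν M hM x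
      have e : ∀ μ : Module.Dual k J, ε ((μ - ν) x) = ε (μ x) * ε (-ν x) := fun μ => by
        rw [LinearMap.sub_apply, sub_eq_add_neg, AddChar.map_add_eq_mul]
      rw [Finset.sum_congr rfl fun μ _ => e μ, ← Finset.sum_mul, h]
      split_ifs
      · rw [mul_assoc, ← AddChar.map_add_eq_mul, add_neg_cancel, AddChar.map_zero_eq_one, mul_one]
      · rw [zero_mul]
    rw [Finset.sum_congr rfl fun x _ => this x, ← Finset.sum_filter, Finset.sum_const,
      nsmul_eq_mul, mul_comm, ← Fintype.card_subtype, ← Nat.card_eq_fintype_card]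
  rw [← h1, Finset.sum_comm, Finset.sum_congr rfl fun μ _ => sum_dual_apply hε (μ - ν)]
  simp only [sub_eq_zero]
  rw [Finset.sum_ite_eq' M ν, if_pos ((hM ν).2 fun _ _ => rfl)]

end Fourier

/-! ### From characters of A + I to monomial characters of A + J. -/

section Switch

variable {k H J : Type*} [Field k] [CommGroup H] [NonUnitalRing J] [Module k J]
  [IsScalarTower k J J] [SMulCommClass k J J]
  [DistribMulAction H J] [DistribMulAction Hᵐᵒᵖ J] [SMulCommClass H Hᵐᵒᵖ J]
  [SMulCommClass H k J] [SMulCommClass Hᵐᵒᵖ k J] [IsTriangularPair H J]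

/-- The function `h + x ↦ θ(h) ε(μ(x))` on `G`. -/
noncomputable def formFun (ε : AddChar k ℂ) (θ : H → ℂ) (μ : Module.Dual k J)
    (g : TriGroup H J) : ℂ := θ g.h * ε (μ g.x)

theorem formFun_apply (ε : AddChar k ℂ) (θ : H → ℂ) (μ : Module.Dual k J) (g : TriGroup H J) :
    formFun ε θ μ g = θ g.h * ε (μ g.x) := rfl

/-- The subgroup `A + J` of `G`, for `A ≤ H`. -/
noncomputable def fullPreimage (J : Type*) {H : Type*} [CommGroup H] [NonUnitalRing J]
    [DistribMulAction H J] [DistribMulAction Hᵐᵒᵖ J] [SMulCommClass H Hᵐᵒᵖ J]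
    [IsTriangularPair H J] (A : Subgroup H) : Subgroup (TriGroup H J) := A.comap projH

theorem mem_fullPreimage {A : Subgroup H} {g : TriGroup H J} :
    g ∈ fullPreimage J A ↔ g.h ∈ A := Iff.rfl

theorem ract_conj_x (g : TriGroup H J) (w : J) :
    ract (⟨1, w⟩ : TriGroup H J) ((⟨1, w⟩ * g * (⟨1, w⟩ : TriGroup H J)⁻¹).x) = g.x + ract g w - g.h •> w := by
  have h1 := mul_x_eq_ract (⟨1, w⟩ * g * (⟨1, w⟩ : TriGroup H J)⁻¹) ⟨1, w⟩
  have h2 : ((⟨1, w⟩ : TriGroup H J) * g * (⟨1, w⟩ : TriGroup H J)⁻¹).h = g.h := by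
    simp [h_mul, h_inv]
  rw [inv_mul_cancel_right, mul_x_eq_lact, h2, lact_one_add] at h1
  refine eq_sub_of_add_eq (h1.symm.trans ?_)
  rw [ract_apply]
  abel

/-- The indicator of I times ε(ν) is the average of the ε(μ), μ ∈ M. Averaging further over
conjugation by 1 + J does not affect induction, and orthogonality then keeps only the μ fixed by the
group element. -/
theorem indFun_eq_monomialFun [Fintype (TriGroup H J)] [Finite H] [Finite J] {ε : AddChar k ℂ}
    (hε : ε ≠ 1) (A : Subgroup H) (I : Submodule k J) (K : Subgroup (TriGroup H J))
    (hK : ∀ g, g ∈ K ↔ g.h ∈ A ∧ g.x ∈ I) (ν : Module.Dual k J)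
    (hIJ : ∀ x ∈ I, ∀ y, x * y ∈ I) (hν : ∀ x ∈ I, ∀ y, ν (x * y) = 0)
    (hAI : ∀ h ∈ A, ∀ x : J, h •> x - x ∈ I) (hAν : ∀ h ∈ A, ∀ x : J, ν (h •> x) = ν x)
    (θ : H → ℂ) (M : Finset (Module.Dual k J)) (hM : ∀ μ, μ ∈ M ↔ ∀ i ∈ I, μ i = ν i) :
    indFun K (formFun ε θ ν) = monomialFun (fullPreimage J A) M (formFun ε θ) := by
  classical
  have := Fintype.ofFinite J
  have hstab : ∀ u : TriGroup H J, u.h = 1 → ∀ μ ∈ M, u • μ ∈ M := by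
    intro u hu μ hμ
    rw [hM] at hμ ⊢
    intro i hi
    rw [smul_dual_apply, ract_apply, hu, MulOpposite.op_one, one_smul, map_add, hμ i hi,
      hμ _ (hIJ i hi _), hν i hi, add_zero]
  have hAμ : ∀ μ ∈ M, ∀ h ∈ A, ∀ x : J, μ (h •> x) = μ x := by
    intro μ hμ h hh x
    rw [hM] at hμ
    rw [← sub_eq_zero, ← map_sub, hμ _ (hAI h hh x), map_sub, hAν h hh, sub_self]
  -- Up to constants, `a` is the inducing function on A + I and `b` is the monomial trace. They
  -- differ, but have equal averages over conjugates.
  set a : TriGroup H J → ℂ := fun y =>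
    if y ∈ fullPreimage J A then ∑ μ ∈ M, formFun ε θ μ y else 0 with ha
  set b : TriGroup H J → ℂ := fun y => ∑ μ ∈ M,
    if y ∈ fullPreimage J A ∧ y • μ = μ then formFun ε θ μ y else 0 with hb
  have cJ : (Nat.card J : ℂ) ≠ 0 := Nat.cast_ne_zero.2 Nat.card_pos.ne'
  have cI : (Nat.card I : ℂ) ≠ 0 := Nat.cast_ne_zero.2 Nat.card_pos.ne'
  have cA : (Nat.card A : ℂ) ≠ 0 := Nat.cast_ne_zero.2 Nat.card_pos.ne'
  have hcard := card_coset_annihilator hε I ν M hM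
  have cM : (M.card : ℂ) ≠ 0 := fun h => cJ (by rw [← hcard, h, zero_mul])
  have h1 : ∀ y, (if y ∈ K then formFun ε θ ν y else 0) = (M.card : ℂ)⁻¹ * a y := by
    intro y
    simp only [ha, hK, mem_fullPreimage, formFun_apply, ← Finset.mul_sum,
      sum_coset_annihilator hε I ν M hM]
    by_cases hA : y.h ∈ A <;> by_cases hI : y.x ∈ I <;> simp [hA, hI]
    field_simp
  have h2 : ∀ y, ∑ w : J, a (⟨1, w⟩ * y * (⟨1, w⟩ : TriGroup H J)⁻¹) = Nat.card J * b y := by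
    intro y
    have hh : ∀ w : J, ((⟨1, w⟩ : TriGroup H J) * y * (⟨1, w⟩ : TriGroup H J)⁻¹).h = y.h := by
      intro w
      simp [h_mul, h_inv]
    by_cases hA : y.h ∈ A
    · simp only [ha, hb, mem_fullPreimage, hh, hA, if_true, true_and, formFun_apply]
      -- Conjugation of y by 1 + w is compensated by substituting (1 + w)μ for μ. What remains is
      -- the factor ε((yμ - μ)(w)), whose sum over w detects yμ = μ.
      have e1 : ∀ w : J, ∑ μ ∈ M, θ y.h *
          ε (μ ((⟨1, w⟩ : TriGroup H J) * y * (⟨1, w⟩ : TriGroup H J)⁻¹).x) =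
          ∑ μ ∈ M, θ y.h * ε (μ y.x) * ε ((y • μ - μ) w) := by
        intro w
        refine Finset.sum_nbij' (fun μ => (⟨1, w⟩ : TriGroup H J)⁻¹ • μ)
          (fun μ => (⟨1, w⟩ : TriGroup H J) • μ) ?_ ?_ ?_ ?_ ?_
        · exact fun μ hμ => hstab _ (by simp [h_inv]) μ hμ
        · exact fun μ hμ => hstab _ rfl μ hμ
        · exact fun μ _ => smul_inv_smul _ _
        · exact fun μ _ => inv_smul_smul _ _
        · intro μ hμ
          have hμ' := hstab (⟨1, w⟩ : TriGroup H J)⁻¹ (by simp [h_inv]) μ hμ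
          obtain ⟨μ', rfl⟩ : ∃ μ', μ = (⟨1, w⟩ : TriGroup H J) • μ' :=
            ⟨(⟨1, w⟩ : TriGroup H J)⁻¹ • μ, (smul_inv_smul _ _).symm⟩
          rw [inv_smul_smul] at hμ' ⊢
          rw [smul_dual_apply, ract_conj_x, mul_assoc, ← AddChar.map_add_eq_mul, map_sub, map_add,
            hAμ μ' hμ' _ hA, LinearMap.sub_apply, smul_dual_apply, add_sub_assoc]
      rw [Finset.sum_congr rfl fun w _ => e1 w, Finset.sum_comm, Finset.mul_sum]
      refine Finset.sum_congr rfl fun μ _ => ?_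
      rw [← Finset.mul_sum, sum_dual_apply hε]
      simp only [sub_eq_zero]
      split_ifs <;> ring
    · simp [ha, hb, mem_fullPreimage, hh, hA]
  funext g
  have h3 : ∑ s : TriGroup H J, a (s⁻¹ * g * s) = ∑ s : TriGroup H J, b (s⁻¹ * g * s) := by
    apply mul_left_cancel₀ cJ
    rw [Finset.mul_sum (f := fun s => b (s⁻¹ * g * s)),
      ← Finset.sum_congr rfl fun s _ => h2 (s⁻¹ * g * s), Finset.sum_comm,
      Finset.sum_congr rfl fun w _ => sum_conj_mul_right a ⟨1, w⟩ g, Finset.sum_const,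
      Finset.card_univ, nsmul_eq_mul, Nat.card_eq_fintype_card]
  rw [indFun, monomialFun, Finset.sum_congr rfl fun s _ => h1 _, ← Finset.mul_sum, h3,
    card_of_mem_iff K A I hK, card_of_mem_iff (fullPreimage J A) A (⊤ : Submodule k J)
      (fun g => by simp [mem_fullPreimage])]
  have hT : Nat.card (⊤ : Submodule k J) = Nat.card J := Nat.card_congr Submodule.topEquiv.toEquiv
  rw [hT]
  push_cast
  rw [← hcard, ← mul_assoc]
  congr 1
  field_simp
  refine Finset.sum_congr rfl fun s _ => Finset.sum_congr rfl fun x _ => ?_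
  congr

end Switch

end Triangular
namespace Triangular

/-! ### Splitting subgroups of G by averaging. -/

section Splitting

variable {k H J : Type*} [Field k] [CommGroup H] [NonUnitalRing J] [Module k J]
  [IsScalarTower k J J] [SMulCommClass k J J]
  [DistribMulAction H J] [DistribMulAction Hᵐᵒᵖ J] [SMulCommClass H Hᵐᵒᵖ J]
  [SMulCommClass H k J] [SMulCommClass Hᵐᵒᵖ k J] [IsTriangularPair H J]

theorem cast_card_ne_zero [Finite H] (hchar : ¬ ringChar k ∣ Nat.card H) (A : Subgroup H) :
    (Nat.card A : k) ≠ 0 := fun h =>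
  hchar (((ringChar.spec k _).1 h).trans A.card_subgroup_dvd_card)

theorem sub_mem_of_h_eq {K : Subgroup (TriGroup H J)} {I : Submodule k J}
    (hI : ∀ x, (⟨1, x⟩ : TriGroup H J) ∈ K ↔ x ∈ I)
    (hr : ∀ (g : TriGroup H J), ∀ x ∈ I, ract g x ∈ I) {g g' : TriGroup H J} (hg : g ∈ K)
    (hg' : g' ∈ K) (h : g.h = g'.h) : g.x - g'.x ∈ I := by
  have h1 := K.mul_mem hg (K.inv_mem hg')
  rw [mul_inv_of_h_eq h, hI] at h1
  simpa using hr g' _ h1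

/-- A subgroup `K` of `G` whose intersection with `1 + J` is `1 + I` for a right ideal `I` is
conjugate under `1 + J` to a subgroup of the form `A + I'` with `A ≤ H`. -/
theorem exists_conj_split [Finite H] (hchar : ¬ ringChar k ∣ Nat.card H)
    (K : Subgroup (TriGroup H J)) (I : Submodule k J)
    (hI : ∀ x, (⟨1, x⟩ : TriGroup H J) ∈ K ↔ x ∈ I)
    (hr : ∀ (g : TriGroup H J), ∀ x ∈ I, ract g x ∈ I) :
    ∃ u : TriGroup H J, ∀ g, u * g * u⁻¹ ∈ K ↔ g.h ∈ K.map projH ∧ lact u g.x ∈ I := by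
  classical
  have := Fintype.ofFinite (K.map projH)
  have hc : ∀ h : K.map (projH : TriGroup H J →* H), ∃ x : J, (⟨h, x⟩ : TriGroup H J) ∈ K := by
    rintro ⟨_, g, hg, rfl⟩
    exact ⟨g.x, hg⟩
  choose c hc using hc
  have hn := cast_card_ne_zero (k := k) hchar (K.map (projH : TriGroup H J →* H))
  set n : k := (Nat.card (K.map (projH : TriGroup H J →* H)) : k) with hnn
  -- Here c is a section of K → H, regarded as a cocycle modulo I. Its average z satisfies g(1 + z)
  -- ≡ (1 + z)h modulo I for every g ∈ K with H-component h.
  set z : J := n⁻¹ • ∑ h : K.map (projH : TriGroup H J →* H), c h <• (h : H)⁻¹ with hz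
  have key : ∀ g ∈ K, lact g z + g.x - z <• g.h ∈ I := by
    intro g hg
    have hgK : g.h ∈ K.map (projH : TriGroup H J →* H) := ⟨g, hg, rfl⟩
    have e1 : ∑ h : K.map (projH : TriGroup H J →* H), c h <• (h : H)⁻¹ <• g.h =
        ∑ h : K.map (projH : TriGroup H J →* H), c (⟨g.h, hgK⟩ * h) <• (h : H)⁻¹ := by
      symm
      refine Fintype.sum_equiv (Equiv.mulLeft ⟨g.h, hgK⟩) _ _ fun h => ?_
      rw [← mul_smul, ← MulOpposite.op_mul]
      simp
    have e2 : lact g z + g.x - z <• g.h = n⁻¹ • ∑ h : K.map (projH : TriGroup H J →* H),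
        (lact g (c h) + g.x <• (h : H) - c (⟨g.h, hgK⟩ * h)) <• (h : H)⁻¹ := by
      have e3 : g.x = n⁻¹ • ∑ h : K.map (projH : TriGroup H J →* H), g.x <• (h : H) <• (h : H)⁻¹ := by
        simp only [← mul_smul, ← MulOpposite.op_mul, mul_inv_cancel,
          MulOpposite.op_one, one_smul, Finset.sum_const, Finset.card_univ]
        rw [← Nat.card_eq_fintype_card, ← Nat.cast_smul_eq_nsmul k, inv_smul_smul₀ hn]
      have e4 : lact g z = n⁻¹ • ∑ h : K.map (projH : TriGroup H J →* H),
          lact g (c h) <• (h : H)⁻¹ := by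
        rw [hz, lact_smul, map_sum]
        congr 1
        refine Finset.sum_congr rfl fun h _ => ?_
        have := lact_ract g ⟨(h : H)⁻¹, 0⟩ (c h)
        simpa [ract_apply] using this
      have e5 : z <• g.h = n⁻¹ • ∑ h : K.map (projH : TriGroup H J →* H),
          c (⟨g.h, hgK⟩ * h) <• (h : H)⁻¹ := by
        rw [hz, smul_comm, Finset.smul_sum, e1]
      conv_lhs => rw [e4, e5]; enter [1, 2]; rw [e3]
      rw [← smul_add, ← smul_sub, ← Finset.sum_add_distrib, ← Finset.sum_sub_distrib]
      simp only [smul_sub, smul_add]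
    rw [e2]
    refine I.smul_mem _ (I.sum_mem fun h _ => ?_)
    have h1 := sub_mem_of_h_eq hI hr (K.mul_mem hg (hc h)) (hc (⟨g.h, hgK⟩ * h)) rfl
    rw [mul_x_eq_lact] at h1
    have := hr ⟨(h : H)⁻¹, 0⟩ _ h1
    simpa [ract_apply] using this
  set u : TriGroup H J := ⟨1, z⟩ with hu
  have hcoset : ∀ g, u * g * u⁻¹ ∈ K → lact u g.x ∈ I := by
    intro g hg
    have h1 := key _ hg
    have h2 : (u * g * u⁻¹ * u).x = (u * g).x := by rw [inv_mul_cancel_right]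
    have h3 : (u * g * u⁻¹).h = g.h := by simp [h_mul, h_inv, hu]
    rw [mul_x_eq_lact (u * g * u⁻¹) u, mul_x_eq_lact u g] at h2
    have h4 : u.h = 1 := rfl
    have h5 : u.x = z := rfl
    rw [h4, h5, MulOpposite.op_one, one_smul] at h2
    rwa [h2, h3, add_sub_cancel_right] at h1
  refine ⟨u, fun g => ⟨fun hg => ⟨⟨_, hg, ?_⟩, hcoset g hg⟩, ?_⟩⟩
  · change (u * g * u⁻¹).h = g.h
    simp [h_mul, h_inv, hu]
  · rintro ⟨⟨g₁, hg₁, hh⟩, hx⟩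
    change g₁.h = g.h at hh
    set g' := u⁻¹ * g₁ * u with hg'
    have e : u * g' * u⁻¹ = g₁ := by rw [hg']; group
    have hx' := hcoset g' (by rwa [e])
    have hg'h : g.h = g'.h := by rw [hg', h_conj, hh]
    -- Both g and g' have J-component in u⁻¹I and the same H-component, so their quotient is 1 + y
    -- with uy ∈ I.
    have h1 : u * g * u⁻¹ = u * (g * g'⁻¹) * u⁻¹ * g₁ := by rw [← e]; group
    rw [h1, mul_inv_of_h_eq hg'h]
    refine K.mul_mem ?_ hg₁
    have h2 := conj_one_add u⁻¹ (ract g'⁻¹ (g.x - g'.x))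
    rw [inv_inv] at h2
    rw [h2, hI, cj_apply, inv_inv, lact_ract, lact_ract, map_sub]
    exact hr _ _ (hr _ _ (I.sub_mem hx hx'))

end Splitting

/-! ### Extending linear characters of subgroups of H. -/

section Characters

variable {H : Type*} [CommGroup H] [Finite H]

theorem hasEnoughRootsOfUnity_complex (A : Type*) [CommGroup A] [Finite A] :
    HasEnoughRootsOfUnity ℂ (Monoid.exponent A) := by
  have : NeZero (Monoid.exponent A) := ⟨Monoid.exponent_ne_zero_of_finite⟩
  infer_instance

open Classical in
theorem sum_monoidHom_apply (A : Type*) [CommGroup A] [Finite A] [Fintype (A →* ℂˣ)] (a : A) :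
    ∑ ψ : A →* ℂˣ, (ψ a : ℂ) = if a = 1 then (Nat.card A : ℂ) else 0 := by
  have := hasEnoughRootsOfUnity_complex A
  split_ifs with h
  · simp only [h, map_one, Units.val_one, Finset.sum_const, Finset.card_univ, nsmul_eq_mul, mul_one]
    rw [← Nat.card_eq_fintype_card, CommGroup.card_monoidHom_of_hasEnoughRootsOfUnity]
  · obtain ⟨φ, hφ⟩ := CommGroup.exists_apply_ne_one_of_hasEnoughRootsOfUnity A ℂ h
    have key : ∑ ψ : A →* ℂˣ, (ψ a : ℂ) = φ a * ∑ ψ : A →* ℂˣ, (ψ a : ℂ) := by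
      rw [Finset.mul_sum]
      exact (Fintype.sum_equiv (Equiv.mulLeft φ) _ _ fun ψ => by simp).symm
    have h2 : (1 - (φ a : ℂ)) * ∑ ψ : A →* ℂˣ, (ψ a : ℂ) = 0 := by linear_combination key
    refine (mul_eq_zero.1 h2).resolve_left (sub_ne_zero.2 fun h3 => hφ ?_)
    exact Units.ext h3.symm

open Classical in
/-- A linear character `θ` of `A ≤ B`, extended by zero and scaled by `[B : A]`, is the sum of
its extensions to `B`. -/
theorem exists_sum_extensions (A B : Subgroup H) (hAB : A ≤ B) [Fintype (B →* ℂˣ)] (θ : H → ℂ)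
    (h1 : θ 1 = 1) (hmul : ∀ a ∈ A, ∀ b ∈ A, θ (a * b) = θ a * θ b) :
    ∃ T : Finset (B →* ℂˣ), ∀ h : B,
      ∑ ψ ∈ T, (ψ h : ℂ) = if (h : H) ∈ A then (Nat.card B : ℂ) / Nat.card A * θ h else 0 := by
  have := Fintype.ofFinite A
  have cA : (Nat.card A : ℂ) ≠ 0 := Nat.cast_ne_zero.2 Nat.card_pos.ne'
  have hinv : ∀ a ∈ A, θ a * θ a⁻¹ = 1 := fun a ha => by
    rw [← hmul a ha _ (inv_mem ha), mul_inv_cancel, h1]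
  refine ⟨Finset.univ.filter fun ψ => ∀ (a : H) (ha : a ∈ A), (ψ ⟨a, hAB ha⟩ : ℂ) = θ a, ?_⟩
  -- Orthogonality on A expresses the condition that ψ extends θ as a character sum. Orthogonality
  -- over the dual of B then evaluates the sum over all ψ.
  have hcoef : ∀ ψ : B →* ℂˣ, ∑ a : A, θ (a : H)⁻¹ * (ψ ⟨a, hAB a.2⟩ : ℂ) =
      if ∀ (a : H) (ha : a ∈ A), (ψ ⟨a, hAB ha⟩ : ℂ) = θ a then (Nat.card A : ℂ) else 0 := by
    intro ψ
    split_ifs with h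
    · rw [Finset.sum_congr rfl fun a _ => by
        rw [h a a.2, mul_comm, hinv a a.2], Finset.sum_const, Finset.card_univ, nsmul_eq_mul,
        mul_one, Nat.card_eq_fintype_card]
    · push Not at h
      obtain ⟨b, hb, hne⟩ := h
      set S := ∑ a : A, θ (a : H)⁻¹ * (ψ ⟨a, hAB a.2⟩ : ℂ) with hS
      have key : θ b⁻¹ * (ψ ⟨b, hAB hb⟩ : ℂ) * S = S := by
        rw [hS, Finset.mul_sum]
        refine Fintype.sum_equiv (Equiv.mulLeft (⟨b, hb⟩ : A)) _ _ fun a => ?_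
        have e1 : θ (((⟨b, hb⟩ * a : A) : H))⁻¹ = θ b⁻¹ * θ (a : H)⁻¹ := by
          rw [← hmul _ (inv_mem hb) _ (inv_mem a.2), Subgroup.coe_mul, mul_inv]
        have e2 : ψ ⟨((⟨b, hb⟩ * a : A) : H), hAB (⟨b, hb⟩ * a : A).2⟩ =
            ψ ⟨b, hAB hb⟩ * ψ ⟨a, hAB a.2⟩ := by rw [← map_mul]; rfl
        simp only [Equiv.coe_mulLeft, e1, e2, Units.val_mul]
        ring
      have h2 : (1 - θ b⁻¹ * (ψ ⟨b, hAB hb⟩ : ℂ)) * S = 0 := by linear_combination -key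
      refine (mul_eq_zero.1 h2).resolve_left fun h3 => hne ?_
      linear_combination (-θ b) * h3 - (ψ ⟨b, hAB hb⟩ : ℂ) * hinv b hb
  intro h
  rw [Finset.sum_filter]
  have e1 : ∀ ψ : B →* ℂˣ, (if ∀ (a : H) (ha : a ∈ A), (ψ ⟨a, hAB ha⟩ : ℂ) = θ a then (ψ h : ℂ)
      else 0) = (Nat.card A : ℂ)⁻¹ * ∑ a : A, θ (a : H)⁻¹ * (ψ (⟨a, hAB a.2⟩ * h) : ℂ) := by
    intro ψ
    have : ∑ a : A, θ (a : H)⁻¹ * (ψ (⟨a, hAB a.2⟩ * h) : ℂ) =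
        (∑ a : A, θ (a : H)⁻¹ * (ψ ⟨a, hAB a.2⟩ : ℂ)) * ψ h := by
      rw [Finset.sum_mul]
      exact Finset.sum_congr rfl fun a _ => by rw [map_mul, Units.val_mul, mul_assoc]
    rw [this, hcoef]
    split_ifs
    · field_simp
    · simp
  rw [Finset.sum_congr rfl fun ψ _ => e1 ψ, ← Finset.mul_sum, Finset.sum_comm]
  simp only [← Finset.mul_sum, sum_monoidHom_apply]
  split_ifs with hA
  · rw [Finset.sum_eq_single (⟨h, hA⟩⁻¹ : A)]
    · rw [if_pos (by ext; simp)]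
      simp only [InvMemClass.coe_inv, inv_inv]
      field_simp
    · intro a _ ha
      rw [if_neg, mul_zero]
      intro h2
      apply ha
      ext
      have := congrArg (Subtype.val) h2
      simpa using eq_inv_of_mul_eq_one_left this
    · simp
  · rw [Finset.sum_eq_zero, mul_zero]
    intro a _
    rw [if_neg, mul_zero]
    intro h2
    apply hA
    have := congrArg (Subtype.val) h2
    have h3 : (h : H) = (a : H)⁻¹ := eq_inv_of_mul_eq_one_right this
    rw [h3]
    exact inv_mem a.2

end Characters

end Triangular
namespace Triangular

/-! ### Annihilating idempotents and regular orbits. -/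

section Support

variable {k H J : Type*} [Field k] [CommGroup H] [NonUnitalRing J] [Module k J]
  [IsScalarTower k J J] [SMulCommClass k J J]
  [DistribMulAction H J] [DistribMulAction Hᵐᵒᵖ J] [SMulCommClass H Hᵐᵒᵖ J]
  [SMulCommClass H k J] [SMulCommClass Hᵐᵒᵖ k J] [IsTriangularPair H J]

/-- The image in `kH` of the left ideal `{a + y : μ(J(a + y)) = 0}` of `kH + J`. -/
noncomputable def rightAnn (μ : Module.Dual k J) : Ideal (MonoidAlgebra k H) where
  carrier := {a | ∃ y : J, ∀ x, μ (rmul a x + x * y) = 0}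
  zero_mem' := ⟨0, fun x => by simp⟩
  add_mem' := by
    rintro a b ⟨y, hy⟩ ⟨z, hz⟩
    refine ⟨y + z, fun x => ?_⟩
    rw [map_add rmul, LinearMap.add_apply, mul_add, add_add_add_comm, map_add, hy, hz, add_zero]
  smul_mem' := by
    rintro b a ⟨y, hy⟩
    refine ⟨lmul b y, fun x => ?_⟩
    rw [smul_eq_mul, map_mul, Module.End.mul_apply, rmul_comm, ← rmul_apply_mul]
    exact hy _

/-- The image in `kH` of the right ideal `{a + y : μ((a + y)J) = 0}` of `kH + J`. -/
noncomputable def leftAnn (μ : Module.Dual k J) : Ideal (MonoidAlgebra k H) where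
  carrier := {a | ∃ y : J, ∀ x, μ (lmul a x + y * x) = 0}
  zero_mem' := ⟨0, fun x => by simp⟩
  add_mem' := by
    rintro a b ⟨y, hy⟩ ⟨z, hz⟩
    refine ⟨y + z, fun x => ?_⟩
    rw [map_add lmul, LinearMap.add_apply, add_mul, add_add_add_comm, map_add, hy, hz, add_zero]
  smul_mem' := by
    rintro b a ⟨y, hy⟩
    refine ⟨rmul b y, fun x => ?_⟩
    rw [smul_eq_mul, map_mul, Module.End.mul_apply, lmul_comm, rmul_apply_mul]
    exact hy _

/-- By Maschke, kH is semisimple, so I is generated by an idempotent q; take f = 1 - q. -/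
theorem exists_idempotent_mem_iff [Finite H] (hchar : ¬ ringChar k ∣ Nat.card H)
    (I : Ideal (MonoidAlgebra k H)) :
    ∃ f : MonoidAlgebra k H, IsIdempotentElem f ∧ ∀ a, a ∈ I ↔ a * f = 0 := by
  have : NeZero (Nat.card H : k) := ⟨fun h => hchar ((ringChar.spec k _).1 h)⟩
  obtain ⟨q, hq, rfl⟩ := IsSemisimpleRing.ideal_eq_span_idempotent I
  refine ⟨1 - q, hq.one_sub, fun a => ?_⟩
  rw [Ideal.mem_span_singleton']
  constructor
  · rintro ⟨b, rfl⟩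
    rw [mul_assoc, hq.mul_one_sub_self, mul_zero]
  · intro h
    exact ⟨a, by rw [mul_sub, mul_one, sub_eq_zero] at h; exact h.symm⟩

/-- If q + y annihilates μ from the right, then so does q(q + y) = q(1 + y). Translating by 1 + y
thus yields a form that vanishes on Jq. -/
theorem exists_move_right {μ : Module.Dual k J} {q : MonoidAlgebra k H}
    (hq : IsIdempotentElem q) (h : q ∈ rightAnn μ) :
    ∃ u : TriGroup H J, u.h = 1 ∧ ∀ x, μ (ract u (rmul q x)) = 0 := by
  obtain ⟨y, hy⟩ := h
  refine ⟨⟨1, y⟩, rfl, fun x => ?_⟩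
  have := hy (rmul q x)
  rwa [← Module.End.mul_apply, ← map_mul, hq.eq, ← ract_one_add (H := H)] at this

theorem exists_move_left {μ : Module.Dual k J} {q : MonoidAlgebra k H}
    (hq : IsIdempotentElem q) (h : q ∈ leftAnn μ) :
    ∃ u : TriGroup H J, u.h = 1 ∧ ∀ x, μ (lact u (lmul q x)) = 0 := by
  obtain ⟨y, hy⟩ := h
  refine ⟨⟨1, y⟩, rfl, fun x => ?_⟩
  have := hy (lmul q x)
  rwa [← Module.End.mul_apply, ← map_mul, hq.eq, ← lact_one_add (H := H)] at this

theorem rmul_ract (a : MonoidAlgebra k H) (g : TriGroup H J) (x : J) :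
    rmul a (ract g x) = ract g (rmul a x) + x * (rmul a g.x - lmul a g.x) := by
  have h1 : rmul a (x <• g.h) = rmul a x <• g.h := by
    rw [← rmul_of (k := k), rmul_comm, rmul_of]
  rw [ract_apply, ract_apply, map_add, h1, rmul_mul, mul_sub, ← rmul_apply_mul]
  abel

theorem lmul_lact (a : MonoidAlgebra k H) (g : TriGroup H J) (x : J) :
    lmul a (lact g x) = lact g (lmul a x) + (lmul a g.x - rmul a g.x) * x := by
  have h1 : lmul a (g.h •> x) = g.h •> lmul a x := by
    rw [← lmul_of (k := k), lmul_comm, lmul_of]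
  rw [lact_apply, lact_apply, map_add, h1, lmul_mul, sub_mul, rmul_apply_mul]
  abel

/-- An annihilator a + y of μ' gives the annihilator g'(a + y)g'⁻¹ of μ. Its kH-component is still a
because H is commutative. -/
theorem rightAnn_le {μ μ' : Module.Dual k J} (g g' : TriGroup H J)
    (h : ∀ x, μ' (lact g (ract g' x)) = μ x) :
    (rightAnn μ' : Ideal (MonoidAlgebra k H)) ≤ rightAnn μ := by
  rintro a ⟨y, hy⟩
  refine ⟨ract g'⁻¹ (rmul a g'.x - lmul a g'.x) + ract g'⁻¹ (lact g' y), fun x => ?_⟩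
  rw [← h, ← hy (lact g (ract g' x))]
  congr 1
  simp only [mul_add, map_add, ract_mul_apply, ract_ract_inv, ← lact_rmul, rmul_ract,
    lact_mul_apply, lact_ract, ract_apply_mul, ← add_assoc]

theorem leftAnn_le {μ μ' : Module.Dual k J} (g g' : TriGroup H J)
    (h : ∀ x, μ' (lact g (ract g' x)) = μ x) :
    (leftAnn μ' : Ideal (MonoidAlgebra k H)) ≤ leftAnn μ := by
  rintro a ⟨y, hy⟩
  refine ⟨lact g⁻¹ (lmul a g.x - rmul a g.x) + lact g⁻¹ (ract g y), fun x => ?_⟩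
  rw [← h, ← hy (lact g (ract g' x))]
  congr 1
  simp only [lact_ract, add_mul, map_add, lact_mul_apply, lact_lact_inv, ← ract_lmul, lmul_lact,
    ract_apply_mul, ract_mul_apply, ← add_assoc]

theorem cornerMap_apply (e : MonoidAlgebra k H) (x : J) :
    cornerMap e x = rmul e (lmul e x) := rfl

theorem apply_lmul_of_mem_dualCorner {f : MonoidAlgebra k H} (hf : IsIdempotentElem f)
    {μ : Module.Dual k J} (hμ : μ ∈ dualCorner f) (x : J) : μ (lmul f x) = μ x := by
  rw [← hμ (lmul f x), ← hμ x, cornerMap_apply, cornerMap_apply, ← Module.End.mul_apply (lmul f),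
    ← map_mul, hf.eq]

theorem apply_rmul_of_mem_dualCorner {f : MonoidAlgebra k H} (hf : IsIdempotentElem f)
    {μ : Module.Dual k J} (hμ : μ ∈ dualCorner f) (x : J) : μ (rmul f x) = μ x := by
  rw [← hμ (rmul f x), ← hμ x, cornerMap_apply, cornerMap_apply, lmul_rmul,
    ← Module.End.mul_apply (rmul f), ← map_mul, hf.eq]

theorem one_sub_mem_rightAnn {f : MonoidAlgebra k H} {μ : Module.Dual k J}
    (h : ∀ x, μ (rmul f x) = μ x) : 1 - f ∈ rightAnn μ :=
  ⟨0, fun x => by simp [h]⟩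

theorem one_sub_mem_leftAnn {f : MonoidAlgebra k H} {μ : Module.Dual k J}
    (h : ∀ x, μ (lmul f x) = μ x) : 1 - f ∈ leftAnn μ :=
  ⟨0, fun x => by simp [h]⟩

theorem mem_dualCorner_of_apply {e f f' : MonoidAlgebra k H} {μ : Module.Dual k J}
    (hf : e * f = f) (hf' : e * f' = f') (hl : ∀ x, μ (lmul f x) = μ x)
    (hr : ∀ x, μ (rmul f' x) = μ x) : μ ∈ dualCorner e := by
  intro x
  rw [cornerMap_apply, ← hr, ← Module.End.mul_apply, ← map_mul, mul_comm, hf', hr, ← hl,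
    ← Module.End.mul_apply, ← map_mul, mul_comm, hf, hl]

theorem lmul_of_mem_corner {e : MonoidAlgebra k H} (he : IsIdempotentElem e) {x : J}
    (hx : x ∈ corner e) : lmul e x = x := by
  obtain ⟨w, rfl⟩ := hx
  rw [cornerMap_apply, lmul_rmul, ← Module.End.mul_apply (lmul e), ← map_mul, he.eq]

theorem rmul_of_mem_corner {e : MonoidAlgebra k H} (he : IsIdempotentElem e) {x : J}
    (hx : x ∈ corner e) : rmul e x = x := by
  obtain ⟨w, rfl⟩ := hx
  rw [cornerMap_apply, ← Module.End.mul_apply (rmul e), ← map_mul, he.eq]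

theorem cornerMap_lact {e : MonoidAlgebra k H} (g : TriGroup H J)
    (hg : lmul e g.x = rmul e g.x) (x : J) : cornerMap e (lact g x) = lact g (cornerMap e x) := by
  rw [cornerMap_apply, cornerMap_apply, lmul_lact, hg, sub_self, zero_mul, add_zero, lact_rmul]

theorem cornerMap_ract {e : MonoidAlgebra k H} (g : TriGroup H J)
    (hg : lmul e g.x = rmul e g.x) (x : J) : cornerMap e (ract g x) = ract g (cornerMap e x) := by
  rw [cornerMap_apply, cornerMap_apply, ← ract_lmul, rmul_ract, hg, sub_self, mul_zero, add_zero]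

theorem rho_eq (t : H) (a b : TriGroup H J) (x : J) :
    rho t a b x = lact (⟨t, 0⟩ * a) (ract (b⁻¹ * ⟨t⁻¹, 0⟩) x) := by
  rw [lact_mul, ract_mul, lact_ract, lact_ract, lact_ract, lact_ract]
  simp only [rho, lact_apply (⟨t, 0⟩ : TriGroup H J), ract_apply (⟨t⁻¹, 0⟩ : TriGroup H J),
    zero_mul, mul_zero, add_zero]
  rw [← lact_apply, ← ract_apply, ← lact_ract]
  have := lact_ract (⟨t, 0⟩ : TriGroup H J) b⁻¹ (lact a x)
  simp only [lact_apply (⟨t, 0⟩ : TriGroup H J), zero_mul, add_zero] at this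
  rw [lact_ract, this]

theorem self_mem_orbit {e : MonoidAlgebra k H} {μ : Module.Dual k J} (hμ : μ ∈ dualCorner e) :
    μ ∈ orbit e μ := by
  refine ⟨hμ, 1, 1, ⟨rfl, (corner e).zero_mem⟩, 1, ⟨rfl, (corner e).zero_mem⟩, fun x _ => ?_⟩
  rw [rho_eq]
  have h1 : (⟨1, 0⟩ : TriGroup H J) = 1 := rfl
  rw [inv_one, inv_one, h1, one_mul, lact_one, ract_one]

/-- The defining relation of the orbit is imposed on J_e only. It extends to J because t, a and b
commute with x ↦ exe and both forms factor through that map. -/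
theorem apply_of_mem_orbit {e : MonoidAlgebra k H} (he : IsIdempotentElem e)
    {μ ν : Module.Dual k J} (hμ : μ ∈ dualCorner e) (hν : ν ∈ orbit e μ) :
    ∃ g g' : TriGroup H J, ∀ x, ν (lact g (ract g' x)) = μ x := by
  obtain ⟨hνe, t, a, ha, b, hb, h⟩ := hν
  refine ⟨⟨t, 0⟩ * a, b⁻¹ * ⟨t⁻¹, 0⟩, fun x => ?_⟩
  have hb' : ∀ y, cornerMap e (ract b⁻¹ y) = ract b⁻¹ (cornerMap e y) := by
    intro y
    have := cornerMap_ract b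
      ((lmul_of_mem_corner he hb.2).trans (rmul_of_mem_corner he hb.2).symm) (ract b⁻¹ y)
    rw [ract_ract_inv] at this
    rw [this, ract_inv_ract]
  rw [← hμ x, ← h _ ⟨x, rfl⟩, rho_eq, ← hνe]
  congr 1
  rw [lact_mul, ract_mul, cornerMap_lact _ (by simp), cornerMap_lact _
    ((lmul_of_mem_corner he ha.2).trans (rmul_of_mem_corner he ha.2).symm),
    cornerMap_ract _ (by simp), hb', lact_mul, ract_mul]

/-- Regularity criterion: the orbit of `μ ∈ J_e^*` is regular if `e` is the join of idempotents
`f`, `f'` that generate the complements of the left and right annihilators of `μ`. -/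
theorem isRegularOrbit_orbit {f f' : MonoidAlgebra k H} {μ : Module.Dual k J}
    (he : IsIdempotentElem (f + f' - f * f')) (hμ : μ ∈ dualCorner (f + f' - f * f'))
    (hl : ∀ a ∈ leftAnn μ, a * f = 0) (hr : ∀ a ∈ rightAnn μ, a * f' = 0) :
    IsRegularOrbit (f + f' - f * f') (orbit (f + f' - f * f') μ) := by
  refine ⟨⟨μ, hμ, rfl⟩, fun d hd hde hne => ?_⟩
  rw [Set.eq_empty_iff_forall_notMem]
  rintro ν ⟨hν, hνd⟩
  obtain ⟨g, g', hg⟩ := apply_of_mem_orbit he hμ hν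
  have h1 := hl _ (leftAnn_le g g' hg (one_sub_mem_leftAnn (apply_lmul_of_mem_dualCorner hd hνd)))
  have h2 := hr _ (rightAnn_le g g' hg
    (one_sub_mem_rightAnn (apply_rmul_of_mem_dualCorner hd hνd)))
  apply hne
  -- Since (1 - d)f = 0 and (1 - d)f' = 0, also (1 - d)e = 0; with de = d this gives d = e.
  linear_combination -(h1 * (1 - f') + h2) - hde

end Support

end Triangular
namespace Triangular

/-! ### Stabilizer characters as sums of supercharacters. -/

section Cone

variable {k H J : Type*} [Field k] [CommGroup H] [NonUnitalRing J] [Module k J]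
  [IsScalarTower k J J] [SMulCommClass k J J]
  [DistribMulAction H J] [DistribMulAction Hᵐᵒᵖ J] [SMulCommClass H Hᵐᵒᵖ J]
  [SMulCommClass H k J] [SMulCommClass Hᵐᵒᵖ k J] [IsTriangularPair H J]

/-- The functions on `G` that are sums of supercharacters. -/
def superCone (ε : AddChar k ℂ) : AddSubmonoid (TriGroup H J → ℂ) :=
  AddSubmonoid.closure {χ | IsSupercharacter ε χ}

/-- The linear form `x ↦ μ(a⁻¹xa)`. -/
noncomputable def conjForm (a : TriGroup H J) (μ : Module.Dual k J) : Module.Dual k J :=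
  μ ∘ₗ lactₗ k a⁻¹ ∘ₗ ractₗ k a

theorem conjForm_apply (a : TriGroup H J) (μ : Module.Dual k J) (x : J) :
    conjForm a μ x = μ (cj a x) := rfl

/-- This is the equivariance of coefficients required for a monomial representation on linear forms.
-/
theorem formFun_conj (ε : AddChar k ℂ) (θ : H → ℂ) {A : Subgroup H} {μ : Module.Dual k J}
    (hl : ∀ h ∈ A, ∀ x : J, μ (h •> x) = μ x) {a g : TriGroup H J} (ha : a.h ∈ A)
    (hg : g.h ∈ A) (hgμ : g • μ = μ) :
    formFun ε θ (a • μ) (a * g * a⁻¹) = formFun ε θ μ g := by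
  have hh : (a * g * a⁻¹).h = g.h := by simpa using h_conj a⁻¹ g
  have h1 := mul_x_eq_ract (a * g * a⁻¹) a
  rw [inv_mul_cancel_right, hh, mul_x_eq_lact] at h1
  have h2 : μ (ract a (a * g * a⁻¹).x) = μ g.x := by
    rw [eq_sub_of_add_eq h1.symm, map_sub, map_add, lact_apply, map_add, hl _ ha, hl _ hg]
    have h3 := (smul_dual_eq_iff g μ).1 hgμ a.x
    rw [ract_apply, map_add] at h3
    linear_combination h3
  rw [formFun_apply, formFun_apply, hh, smul_dual_apply, h2]

/-- `(A, θ, μ)` defines the linear character `h + x ↦ θ(h) ε(μ(x))` of the subgroup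
`S = A + J_{μ,right}`. -/
structure IsFormPair (A : Subgroup H) (θ : H → ℂ) (μ : Module.Dual k J)
    (S : Subgroup (TriGroup H J)) : Prop where
  one : θ 1 = 1
  mul : ∀ a ∈ A, ∀ b ∈ A, θ (a * b) = θ a * θ b
  left : ∀ h ∈ A, ∀ x : J, μ (h •> x) = μ x
  right : ∀ h ∈ A, ∀ x : J, μ (x <• h) = μ x
  mem : ∀ g, g ∈ S ↔ g.h ∈ A ∧ ∀ y, μ (g.x * y) = 0

namespace IsFormPair

variable {A : Subgroup H} {θ : H → ℂ} {μ : Module.Dual k J} {S : Subgroup (TriGroup H J)}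

theorem apply_lact (p : IsFormPair A θ μ S) {g : TriGroup H J} (hg : g ∈ S) (x : J) :
    μ (lact g x) = μ x := by
  rw [lact_apply, map_add, p.left _ ((p.mem g).1 hg).1, ((p.mem g).1 hg).2, add_zero]

theorem formFun_mul (p : IsFormPair A θ μ S) (ε : AddChar k ℂ) {g g' : TriGroup H J}
    (hg : g ∈ S) (hg' : g' ∈ S) :
    formFun ε θ μ (g * g') = formFun ε θ μ g * formFun ε θ μ g' := by
  rw [formFun_apply, formFun_apply, formFun_apply, mul_x_eq_lact, map_add, p.apply_lact hg,
    p.right _ ((p.mem g').1 hg').1, h_mul, p.mul _ ((p.mem g).1 hg).1 _ ((p.mem g').1 hg').1,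
    AddChar.map_add_eq_mul]
  ring

theorem formFun_conj_self (p : IsFormPair A θ μ S) (ε : AddChar k ℂ) {a g : TriGroup H J}
    (ha : a ∈ S) (hg : g ∈ S) : formFun ε θ μ (a * g * a⁻¹) = formFun ε θ μ g := by
  have h1 : formFun ε θ μ a * formFun ε θ μ a⁻¹ = 1 := by
    rw [← p.formFun_mul ε ha (S.inv_mem ha), mul_inv_cancel, formFun_apply, h_one, p.one,
      TriGroup.one_x, map_zero, AddChar.map_zero_eq_one, mul_one]
  rw [p.formFun_mul ε (S.mul_mem ha hg) (S.inv_mem ha), p.formFun_mul ε ha hg]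
  linear_combination (formFun ε θ μ g) * h1

/-- The right factor a of a⁻¹xa is absorbed into y, so the condition on x is stable under right
multiplication by G. -/
theorem conj_one_add_mem_iff (p : IsFormPair A θ μ S) (a : TriGroup H J) (x : J) :
    a⁻¹ * ⟨1, x⟩ * a ∈ S ↔ ∀ y, μ (lact a⁻¹ x * y) = 0 := by
  rw [conj_one_add, p.mem]
  simp only [one_mem, true_and, cj_apply, lact_ract, ract_apply_mul]
  constructor
  · intro h y
    simpa using h (lact a⁻¹ y)
  · exact fun h y => h _

theorem apply_cj_mul (p : IsFormPair A θ μ S) {a : TriGroup H J} {x : J}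
    (hx : a⁻¹ * ⟨1, x⟩ * a ∈ S) (y : J) : μ (cj a (x * y)) = 0 := by
  rw [conj_one_add, p.mem] at hx
  rw [cj_mul]
  exact hx.2 _

theorem apply_cj_left (p : IsFormPair A θ μ S) {a : TriGroup H J} {h : H}
    (hh : a⁻¹ * ⟨h, 0⟩ * a ∈ S) (x : J) : μ (cj a (h •> x)) = μ (cj a x) := by
  have := p.apply_lact hh (cj a x)
  rwa [← cj_lact, lact_apply, zero_mul, add_zero] at this

theorem apply_cj_right (p : IsFormPair A θ μ S) {a : TriGroup H J} {h : H}
    (hh : a⁻¹ * ⟨h, 0⟩ * a ∈ S) {x : J} (hx : a⁻¹ * ⟨1, x⟩ * a ∈ S) :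
    μ (cj a (x <• h)) = μ (cj a x) := by
  have h1 := cj_ract a ⟨h, 0⟩ x
  rw [ract_apply, mul_zero, add_zero] at h1
  rw [conj_one_add, p.mem] at hx
  rw [h1, ract_apply, map_add, hx.2, add_zero, p.right _ ((p.mem _).1 hh).1]

theorem conj_sub_mem (p : IsFormPair A θ μ S) {a : TriGroup H J} {h : H}
    (hh : a⁻¹ * ⟨h, 0⟩ * a ∈ S) (x : J) : a⁻¹ * ⟨1, h •> x - x⟩ * a ∈ S := by
  rw [conj_one_add, p.mem]
  refine ⟨one_mem _, fun y => ?_⟩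
  have h1 := cj_lact a ⟨h, 0⟩ x
  rw [lact_apply, zero_mul, add_zero] at h1
  change μ (cj a (h •> x - x) * y) = 0
  rw [map_sub, h1, sub_mul, ← lact_mul_apply, map_sub, p.apply_lact hh, sub_self]

/-- Writing h + x = h(1 + h⁻¹x) separates the two factors, and the conjugated form does not see h⁻¹.
-/
theorem formFun_conj_eq (p : IsFormPair A θ μ S) (ε : AddChar k ℂ) {a g : TriGroup H J}
    (hg : a⁻¹ * g * a ∈ S) (hh : a⁻¹ * ⟨g.h, 0⟩ * a ∈ S) :
    formFun ε θ μ (a⁻¹ * g * a) =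
      formFun ε θ μ (a⁻¹ * ⟨g.h, 0⟩ * a) * ε (conjForm a μ g.x) := by
  have hinv : a⁻¹ * ⟨(g.h)⁻¹, 0⟩ * a ∈ S := by
    have e : (⟨g.h, 0⟩ : TriGroup H J)⁻¹ = ⟨(g.h)⁻¹, 0⟩ :=
      inv_eq_of_mul_eq_one_right (by ext <;> simp [h_mul, h_one, TriGroup.mul_x, TriGroup.one_x])
    have := S.inv_mem hh
    rwa [mul_inv_rev, mul_inv_rev, inv_inv, ← mul_assoc, e] at this
  have e : g = ⟨g.h, 0⟩ * ⟨1, (g.h)⁻¹ •> g.x⟩ := by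
    rw [of_mul_one_add, smul_inv_smul]
  have e' : a⁻¹ * g * a =
      (a⁻¹ * ⟨g.h, 0⟩ * a) * (a⁻¹ * ⟨1, (g.h)⁻¹ •> g.x⟩ * a) := by
    conv_lhs => rw [e]
    group
  have h1 : a⁻¹ * ⟨1, (g.h)⁻¹ •> g.x⟩ * a ∈ S := by
    rw [e'] at hg
    exact (S.mul_mem_cancel_left hh).1 hg
  rw [e', p.formFun_mul ε hh h1, conj_one_add, formFun_apply _ _ _ ⟨1, _⟩, p.one, one_mul,
    conjForm_apply, p.apply_cj_left hinv]

end IsFormPair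

/-- The forms x ↦ μ(xy) make up a space whose common kernel is J_{μ,right}. By finite-dimensional
duality this space contains ν - μ. -/
theorem exists_eq_smul_of_eq_on [FiniteDimensional k J] {μ ν : Module.Dual k J}
    (h : ∀ x : J, (∀ y, μ (x * y) = 0) → ν x = μ x) :
    ∃ y : J, ν = (⟨1, y⟩ : TriGroup H J) • μ := by
  let T : J →ₗ[k] Module.Dual k J := (LinearMap.mul k J).flip.compr₂ μ
  have hT : ∀ y x, T y x = μ (x * y) := fun y x => rfl
  have h1 : ν - μ ∈ LinearMap.range T := by
    rw [← Subspace.dualCoannihilator_dualAnnihilator_eq (W := LinearMap.range T),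
      Submodule.mem_dualAnnihilator]
    intro x hx
    rw [Submodule.mem_dualCoannihilator] at hx
    rw [LinearMap.sub_apply, sub_eq_zero]
    exact h x fun y => by rw [← hT]; exact hx _ ⟨y, rfl⟩
  obtain ⟨y, hy⟩ := h1
  refine ⟨y, LinearMap.ext fun x => ?_⟩
  rw [smul_dual_apply, ract_one_add, map_add, ← hT, hy, LinearMap.sub_apply]
  abel

/-- The characters induced from `A + J_{μ,right}` and `A + J_{μ,left}` agree. -/
theorem IsFormPair.indFun_eq [Finite k] [Finite H] [FiniteDimensional k J] [Finite J]
    [Fintype (TriGroup H J)] {ε : AddChar k ℂ} (hε : ε ≠ 1) {A : Subgroup H} {θ : H → ℂ}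
    {μ : Module.Dual k J} {S : Subgroup (TriGroup H J)} (p : IsFormPair A θ μ S) :
    indFun S (formFun ε θ μ) =
      indFun (fullPreimage J A ⊓ MulAction.stabilizer (TriGroup H J) μ) (formFun ε θ μ) := by
  classical
  have : Finite (Module.Dual k J) := Module.finite_of_finite k
  let I : Submodule k J :=
    { carrier := {x | ∀ y, μ (x * y) = 0}
      zero_mem' := fun y => by simp
      add_mem' := fun {a b} ha hb y => by rw [add_mul, map_add, ha, hb, add_zero]
      smul_mem' := fun c x hx y => by rw [smul_mul_assoc, map_smul, hx, smul_zero] }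
  have hI : ∀ x, x ∈ I ↔ ∀ y, μ (x * y) = 0 := fun _ => Iff.rfl
  let M : Finset (Module.Dual k J) := (Set.toFinite {ν | ∀ i ∈ I, ν i = μ i}).toFinset
  have hM : ∀ ν, ν ∈ M ↔ ∀ i ∈ I, ν i = μ i := fun ν => by simp [M]
  have hAI : ∀ h ∈ A, ∀ x : J, h •> x - x ∈ I := by
    intro h hh x
    rw [hI]
    intro y
    rw [sub_mul, ← IsTriangularPair.left_mul, map_sub, p.left h hh, sub_self]
  rw [indFun_eq_monomialFun hε A I S (fun g => p.mem g) μ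
    (fun x hx y => fun z => by rw [mul_assoc]; exact hx _) (fun x hx y => hx y) hAI p.left θ M hM]
  -- The forms agreeing with μ on J_{μ,right} are a single orbit of A + J, so the monomial character
  -- is induced from one stabilizer.
  refine monomialFun_orbit M μ (fun ν => ?_) ?_
  · rw [hM]
    constructor
    · intro h
      obtain ⟨y, rfl⟩ := exists_eq_smul_of_eq_on (H := H) h
      exact ⟨⟨⟨1, y⟩, one_mem A⟩, rfl⟩
    · rintro ⟨⟨g, hg⟩, rfl⟩ i hi
      change μ (ract g i) = μ i
      rw [ract_apply, map_add, hi, add_zero, p.right _ (mem_fullPreimage.1 hg)]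
  · intro a ha ν hν g hg hgν
    refine formFun_conj ε θ (A := A) (fun h hh x => ?_) ha hg hgν
    rw [hM] at hν
    rw [← sub_eq_zero, ← map_sub, hν _ (hAI h hh x), map_sub, p.left h hh, sub_self]

theorem apply_smul_right_of_fixer {f : MonoidAlgebra k H} {μ : Module.Dual k J}
    (hμ : ∀ x, μ (rmul f x) = μ x) {h : H} (hh : h ∈ fixer f) (x : J) : μ (x <• h) = μ x := by
  have hh' : MonoidAlgebra.of k H h * f = f := hh
  rw [← rmul_of (k := k), ← hμ, ← Module.End.mul_apply, ← map_mul, mul_comm, hh', hμ]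

open Classical in
/-- The extension by zero of a linear character of the subgroup `B`. -/
noncomputable def extendZero (B : Subgroup H) (ψ : B →* ℂˣ) (h : H) : ℂ :=
  if hh : h ∈ B then ψ ⟨h, hh⟩ else 0

theorem extendZero_coe {B : Subgroup H} (ψ : B →* ℂˣ) (h : B) : extendZero B ψ h = ψ h := by
  rw [extendZero, dif_pos h.2]

theorem isFormPair_stab {e : MonoidAlgebra k H} (he : IsIdempotentElem e) {μ : Module.Dual k J}
    (hμ : μ ∈ dualCorner e) (ψ : fixer e →* ℂˣ) :
    IsFormPair (fixer e) (extendZero (fixer e) ψ) μ (stab e μ hμ) where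
  one := by
    have := extendZero_coe ψ 1
    simpa using this
  mul a ha b hb := by
    have := extendZero_coe ψ (⟨a, ha⟩ * ⟨b, hb⟩)
    rw [map_mul, Units.val_mul, ← extendZero_coe, ← extendZero_coe] at this
    exact this
  left h hh x := apply_smul_of_mem_fixer hμ hh x
  right h hh x := apply_smul_right_of_fixer (apply_rmul_of_mem_dualCorner he hμ) hh x
  mem _ := Iff.rfl

theorem inducedCharacter_stab_eq [Fintype (TriGroup H J)] (ε : AddChar k ℂ)
    {e : MonoidAlgebra k H} {μ : Module.Dual k J} (hμ : μ ∈ dualCorner e) (ψ : fixer e →* ℂˣ) :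
    inducedCharacter (stab e μ hμ) (xi ε e μ hμ ψ) =
      indFun (stab e μ hμ) (formFun ε (extendZero (fixer e) ψ) μ) := by
  refine inducedCharacter_eq_indFun _ _ _ fun g => ?_
  rw [formFun_apply, extendZero, dif_pos g.2.1]
  rfl

theorem indFun_stabilizer_mem_superCone [Finite k] [Finite H] [FiniteDimensional k J] [Finite J]
    [Fintype (TriGroup H J)] {ε : AddChar k ℂ} (hε : ε ≠ 1) {e : MonoidAlgebra k H}
    (he : IsIdempotentElem e) {μ : Module.Dual k J} (hμ : μ ∈ dualCorner e)
    (hreg : IsRegularOrbit e (orbit e μ)) (ψ : fixer e →* ℂˣ) :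
    indFun (fullPreimage J (fixer e) ⊓ MulAction.stabilizer (TriGroup H J) μ)
      (formFun ε (extendZero (fixer e) ψ) μ) ∈ superCone ε := by
  refine AddSubmonoid.subset_closure ⟨⟨e, he, ψ, orbit e μ, hreg⟩, μ, self_mem_orbit hμ, ?_⟩
  rw [← (isFormPair_stab he hμ ψ).indFun_eq hε]
  exact (inducedCharacter_stab_eq ε hμ ψ).symm

theorem card_fullPreimage_inf_stabilizer {B : Subgroup H} {μ : Module.Dual k J}
    (hr : ∀ h ∈ B, ∀ x : J, μ (x <• h) = μ x) (I : Submodule k J)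
    (hI : ∀ x, x ∈ I ↔ ∀ y, μ (y * x) = 0) :
    Nat.card (fullPreimage J B ⊓ MulAction.stabilizer (TriGroup H J) μ :
      Subgroup (TriGroup H J)) = Nat.card B * Nat.card I := by
  refine card_of_mem_iff _ B I fun g => ?_
  rw [Subgroup.mem_inf, mem_fullPreimage, MulAction.mem_stabilizer_iff, smul_dual_eq_iff]
  refine and_congr_right fun hg => ?_
  simp only [hI, ract_apply, map_add, hr _ hg, add_eq_left]

/-- Induction in stages: B fixes μ from the right, so the two stabilizers are A + J_{μ,left} and B +
J_{μ,left}. Inducing from the first to the second replaces θ by the sum of its extensions to B. -/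
theorem indFun_stabilizer_mem_of_le [Finite H] [Finite J] [Fintype (TriGroup H J)]
    {ε : AddChar k ℂ} (C : AddSubmonoid (TriGroup H J → ℂ)) {A B : Subgroup H} (hAB : A ≤ B)
    {μ : Module.Dual k J} (hr : ∀ h ∈ B, ∀ x : J, μ (x <• h) = μ x) {θ : H → ℂ} (h1 : θ 1 = 1)
    (hmul : ∀ a ∈ A, ∀ b ∈ A, θ (a * b) = θ a * θ b)
    (hC : ∀ ψ : B →* ℂˣ, indFun (fullPreimage J B ⊓ MulAction.stabilizer (TriGroup H J) μ)
      (formFun ε (extendZero B ψ) μ) ∈ C) :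
    indFun (fullPreimage J A ⊓ MulAction.stabilizer (TriGroup H J) μ) (formFun ε θ μ) ∈ C := by
  classical
  have := hasEnoughRootsOfUnity_complex B
  have : Finite (B →* ℂˣ) := Nat.finite_of_card_ne_zero (by
    rw [CommGroup.card_monoidHom_of_hasEnoughRootsOfUnity]
    exact Nat.card_pos.ne')
  have := Fintype.ofFinite (B →* ℂˣ)
  obtain ⟨T, hT⟩ := exists_sum_extensions A B hAB θ h1 hmul
  let I : Submodule k J :=
    { carrier := {x | ∀ y, μ (y * x) = 0}
      zero_mem' := fun y => by simp
      add_mem' := fun {a b} ha hb y => by rw [mul_add, map_add, ha, hb, add_zero]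
      smul_mem' := fun c x hx y => by rw [mul_smul_comm, map_smul, hx, smul_zero] }
  have hI : ∀ x, x ∈ I ↔ ∀ y, μ (y * x) = 0 := fun _ => Iff.rfl
  have cA : (Nat.card A : ℂ) ≠ 0 := Nat.cast_ne_zero.2 Nat.card_pos.ne'
  have cB : (Nat.card B : ℂ) ≠ 0 := Nat.cast_ne_zero.2 Nat.card_pos.ne'
  have cI : (Nat.card I : ℂ) ≠ 0 := Nat.cast_ne_zero.2 Nat.card_pos.ne'
  have key : indFun (fullPreimage J A ⊓ MulAction.stabilizer (TriGroup H J) μ) (formFun ε θ μ) =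
      ∑ ψ ∈ T, indFun (fullPreimage J B ⊓ MulAction.stabilizer (TriGroup H J) μ)
        (formFun ε (extendZero B ψ) μ) := by
    funext g
    simp only [Finset.sum_apply, indFun]
    rw [← Finset.mul_sum, Finset.sum_comm, Finset.mul_sum, Finset.mul_sum]
    refine Finset.sum_congr rfl fun s _ => ?_
    generalize s⁻¹ * g * s = y
    rw [card_fullPreimage_inf_stabilizer hr I hI,
      card_fullPreimage_inf_stabilizer (fun h hh => hr h (hAB hh)) I hI]
    simp only [Subgroup.mem_inf, mem_fullPreimage, formFun_apply]
    by_cases hs : y ∈ MulAction.stabilizer (TriGroup H J) μ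
    · by_cases hB : y.h ∈ B
      · simp only [hs, hB, and_true, if_true]
        rw [← Finset.sum_mul, Finset.sum_congr rfl fun ψ _ => extendZero_coe ψ ⟨y.h, hB⟩, hT]
        push_cast
        split_ifs
        · field_simp
        · simp
      · have hA : y.h ∉ A := fun h => hB (hAB h)
        simp [hA, hB]
    · simp [hs]
  rw [key]
  exact C.sum_mem fun ψ _ => hC ψ

/-- Right translation by u stays in the orbit of μ. Left translation by v leaves the orbit, but it
commutes with the action and therefore preserves stabilizers. Together they bring μ to a form with a
regular orbit. -/
theorem exists_move_mem_superCone [Finite k] [Finite H] [FiniteDimensional k J] [Finite J]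
    [Fintype (TriGroup H J)] (hchar : ¬ ringChar k ∣ Nat.card H) {ε : AddChar k ℂ} (hε : ε ≠ 1)
    {A : Subgroup H} {θ : H → ℂ} (h1 : θ 1 = 1)
    (hmul : ∀ a ∈ A, ∀ b ∈ A, θ (a * b) = θ a * θ b) (μ : Module.Dual k J)
    (hl : ∀ h ∈ A, ∀ x : J, μ (h •> x) = μ x) :
    ∃ u : TriGroup H J, u.h = 1 ∧
      indFun (fullPreimage J A ⊓ MulAction.stabilizer (TriGroup H J) (u • μ))
        (formFun ε θ (u • μ)) ∈ superCone ε := by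
  obtain ⟨f', hf', hr⟩ := exists_idempotent_mem_iff hchar (rightAnn μ : Ideal (MonoidAlgebra k H))
  obtain ⟨u, hu, hu'⟩ := exists_move_right hf'.one_sub ((hr _).2 hf'.one_sub_mul_self)
  refine ⟨u, hu, ?_⟩
  set μ₁ := u • μ with hμ₁
  have r₁ : ∀ x, μ₁ (rmul f' x) = μ₁ x := fun x => by
    have := hu' x
    rw [map_sub, map_one, LinearMap.sub_apply, Module.End.one_apply, map_sub, map_sub,
      sub_eq_zero] at this
    exact this.symm
  have hr₁ : (rightAnn μ₁ : Ideal (MonoidAlgebra k H)) ≤ rightAnn μ :=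
    rightAnn_le 1 u⁻¹ fun x => by rw [lact_one, hμ₁, smul_dual_apply, ract_ract_inv]
  have hl₁ : ∀ h ∈ A, ∀ x : J, μ₁ (h •> x) = μ₁ x := by
    intro h hh x
    have := lact_ract (⟨h, 0⟩ : TriGroup H J) u x
    simp only [lact_apply, zero_mul, add_zero] at this
    rw [hμ₁, smul_dual_apply, smul_dual_apply, ← this, hl h hh]
  obtain ⟨f, hf, hfl⟩ := exists_idempotent_mem_iff hchar (leftAnn μ₁ : Ideal (MonoidAlgebra k H))
  obtain ⟨v, hv, hv'⟩ := exists_move_left hf.one_sub ((hfl _).2 hf.one_sub_mul_self)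
  set μ₂ : Module.Dual k J := μ₁ ∘ₗ lactₗ k v with hμ₂
  have hμ₂' : ∀ x, μ₂ x = μ₁ (lact v x) := fun _ => rfl
  have l₂ : ∀ x, μ₂ (lmul f x) = μ₂ x := fun x => by
    have := hv' x
    rw [map_sub, map_one, LinearMap.sub_apply, Module.End.one_apply, map_sub, map_sub,
      sub_eq_zero] at this
    exact this.symm
  have r₂ : ∀ x, μ₂ (rmul f' x) = μ₂ x := fun x => by rw [hμ₂', lact_rmul, r₁, hμ₂']
  have inv₂ : ∀ x, μ₂ (lact v⁻¹ (ract (1 : TriGroup H J) x)) = μ₁ x := fun x => by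
    rw [ract_one, hμ₂', lact_lact_inv]
  have hA : ∀ h ∈ A, MonoidAlgebra.of k H h * f = f := by
    intro h hh
    have : MonoidAlgebra.of k H h - 1 ∈ leftAnn μ₁ := ⟨0, fun x => by
      rw [map_sub, map_one, LinearMap.sub_apply, Module.End.one_apply, lmul_of, zero_mul,
        add_zero, map_sub, hl₁ h hh, sub_self]⟩
    rw [hfl, sub_mul, one_mul, sub_eq_zero] at this
    exact this
  -- The join of f and f', the smallest idempotent acting as identity on both.
  set e := f + f' - f * f' with he
  have hff : f * f = f := hf
  have hff' : f' * f' = f' := hf'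
  have he_idem : IsIdempotentElem e := by
    change e * e = e
    rw [he]
    linear_combination (1 - f') * (1 - f') * hff + (1 - f) * hff'
  have hμ₂e : μ₂ ∈ dualCorner e := by
    refine mem_dualCorner_of_apply ?_ ?_ l₂ r₂
    · rw [he]; linear_combination (1 - f') * hff
    · rw [he]; linear_combination (1 - f) * hff'
  have hreg : IsRegularOrbit e (orbit e μ₂) :=
    isRegularOrbit_orbit he_idem hμ₂e
      (fun a ha => (hfl a).1 (leftAnn_le _ _ inv₂ ha))
      (fun a ha => (hr a).1 (hr₁ (rightAnn_le _ _ inv₂ ha)))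
  have hle : A ⊓ fixer f' ≤ fixer e := by
    rintro h ⟨hh, hh'⟩
    have e1 := hA h hh
    have e2 : MonoidAlgebra.of k H h * f' = f' := hh'
    change MonoidAlgebra.of k H h * e = e
    rw [he]
    linear_combination (1 - f') * e1 + e2
  -- If g = h + x fixes μ₁, then h - 1 + x annihilates μ₁ from the right, which forces hf' = f'.
  have hK : fullPreimage J A ⊓ MulAction.stabilizer (TriGroup H J) μ₁ =
      fullPreimage J (A ⊓ fixer f') ⊓ MulAction.stabilizer (TriGroup H J) μ₂ := by
    ext g
    simp only [Subgroup.mem_inf, mem_fullPreimage, MulAction.mem_stabilizer_iff,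
      smul_dual_eq_iff]
    constructor
    · rintro ⟨hg, hs⟩
      refine ⟨⟨hg, ?_⟩, fun x => by rw [hμ₂', hμ₂', lact_ract, hs]⟩
      have : MonoidAlgebra.of k H g.h - 1 ∈ rightAnn μ := hr₁ ⟨g.x, fun x => by
        have := hs x
        rw [ract_apply] at this
        rw [map_sub, map_one, LinearMap.sub_apply, Module.End.one_apply, rmul_of,
          sub_add_eq_add_sub, map_sub, this, sub_self]⟩
      rw [hr, sub_mul, one_mul, sub_eq_zero] at this
      exact this
    · rintro ⟨⟨hg, _⟩, hs⟩
      refine ⟨hg, fun x => ?_⟩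
      have := hs (lact v⁻¹ x)
      rwa [hμ₂', hμ₂', lact_ract, lact_lact_inv] at this
  -- With v = 1 + y and g = h + x, invariance of μ₁ under g at the point y, together with hf' = f',
  -- gives μ₁(yx) = 0. Hence μ₂(x) = μ₁(x).
  have hF : ∀ g ∈ fullPreimage J A ⊓ MulAction.stabilizer (TriGroup H J) μ₁,
      formFun ε θ μ₁ g = formFun ε θ μ₂ g := by
    intro g hg
    have hg' := hg
    rw [hK] at hg'
    have hs := (smul_dual_eq_iff g μ₁).1 hg.2 v.x
    rw [ract_apply, map_add, apply_smul_right_of_fixer r₁ (mem_fullPreimage.1 hg'.1).2,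
      add_eq_left] at hs
    rw [formFun_apply, formFun_apply, hμ₂', lact_apply, hv, one_smul, map_add, hs, add_zero]
  rw [indFun_congr hK hF]
  refine indFun_stabilizer_mem_of_le _ hle
    (fun h hh => apply_smul_right_of_fixer (apply_rmul_of_mem_dualCorner he_idem hμ₂e) hh) h1
    (fun a ha b hb => hmul a ha.1 b hb.1) fun ψ => ?_
  exact indFun_stabilizer_mem_superCone hε he_idem hμ₂e hreg ψ

end Cone

end Triangular
namespace Triangular

/-! ### Products of supercharacters. -/

section Product

variable {k H J : Type*} [Field k] [CommGroup H] [NonUnitalRing J] [Module k J]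
  [IsScalarTower k J J] [SMulCommClass k J J]
  [DistribMulAction H J] [DistribMulAction Hᵐᵒᵖ J] [SMulCommClass H Hᵐᵒᵖ J]
  [SMulCommClass H k J] [SMulCommClass Hᵐᵒᵖ k J] [IsTriangularPair H J]

/-- After the passage to A + J, each orbit on M is represented by the form that
`exists_move_mem_superCone` supplies. The translating element lies in 1 + J, hence in A + J. -/
theorem indFun_form_mem_superCone [Finite k] [Finite H] [FiniteDimensional k J] [Finite J]
    [Fintype (TriGroup H J)] (hchar : ¬ ringChar k ∣ Nat.card H) {ε : AddChar k ℂ} (hε : ε ≠ 1)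
    {A : Subgroup H} {θ : H → ℂ} (h1 : θ 1 = 1)
    (hmul : ∀ a ∈ A, ∀ b ∈ A, θ (a * b) = θ a * θ b) (I : Submodule k J)
    (K : Subgroup (TriGroup H J)) (hK : ∀ g, g ∈ K ↔ g.h ∈ A ∧ g.x ∈ I) (ν : Module.Dual k J)
    (hIJ : ∀ x ∈ I, ∀ y, x * y ∈ I) (hIA : ∀ h ∈ A, ∀ x ∈ I, x <• h ∈ I)
    (hν : ∀ x ∈ I, ∀ y, ν (x * y) = 0) (hνA : ∀ h ∈ A, ∀ x ∈ I, ν (x <• h) = ν x)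
    (hAI : ∀ h ∈ A, ∀ x : J, h •> x - x ∈ I) (hAν : ∀ h ∈ A, ∀ x : J, ν (h •> x) = ν x) :
    indFun K (formFun ε θ ν) ∈ superCone ε := by
  classical
  have : Finite (Module.Dual k J) := Module.finite_of_finite k
  let M : Finset (Module.Dual k J) := (Set.toFinite {μ | ∀ i ∈ I, μ i = ν i}).toFinset
  have hM : ∀ μ, μ ∈ M ↔ ∀ i ∈ I, μ i = ν i := fun μ => by simp [M]
  have hl : ∀ μ ∈ M, ∀ h ∈ A, ∀ x : J, μ (h •> x) = μ x := by
    intro μ hμ h hh x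
    rw [hM] at hμ
    rw [← sub_eq_zero, ← map_sub, hμ _ (hAI h hh x), map_sub, hAν h hh, sub_self]
  rw [indFun_eq_monomialFun hε A I K hK ν hIJ hν hAI hAν θ M hM]
  refine monomialFun_mem _ M ?_ ?_ ?_
  · intro g hg μ hμ
    rw [hM] at hμ ⊢
    intro i hi
    rw [mem_fullPreimage] at hg
    rw [smul_dual_apply, ract_apply, map_add, hμ _ (hIA _ hg _ hi), hνA _ hg _ hi,
      hμ _ (hIJ _ hi _), hν _ hi, add_zero]
  · intro a ha μ hμ g hg hgμ
    exact formFun_conj ε θ (hl μ hμ) ha hg hgμ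
  · intro μ hμ
    obtain ⟨u, hu, h⟩ := exists_move_mem_superCone hchar hε h1 hmul μ (hl μ hμ)
    exact ⟨u, mem_fullPreimage.2 (hu ▸ one_mem A), h⟩

/-- Once K is split as A + I, the product of the conjugated linear characters is given by one pair
(θ, ν): θ is its restriction to A, and ν is the sum of the conjugated forms. -/
theorem indFun_conj_inf_mem_superCone [Finite k] [Finite H] [FiniteDimensional k J] [Finite J]
    [Fintype (TriGroup H J)] (hchar : ¬ ringChar k ∣ Nat.card H) {ε : AddChar k ℂ} (hε : ε ≠ 1)
    {A₁ A₂ : Subgroup H} {θ₁ θ₂ : H → ℂ} {μ₁ μ₂ : Module.Dual k J}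
    {S₁ S₂ : Subgroup (TriGroup H J)} (p₁ : IsFormPair A₁ θ₁ μ₁ S₁)
    (p₂ : IsFormPair A₂ θ₂ μ₂ S₂) (a b : TriGroup H J) (K : Subgroup (TriGroup H J))
    (hK : ∀ g, g ∈ K ↔ a⁻¹ * g * a ∈ S₁ ∧ b⁻¹ * g * b ∈ S₂) (A : Subgroup H)
    (I : Submodule k J) (hKI : ∀ g, g ∈ K ↔ g.h ∈ A ∧ g.x ∈ I)
    (hr : ∀ (g : TriGroup H J), ∀ x ∈ I, ract g x ∈ I) :
    indFun K (fun g => formFun ε θ₁ μ₁ (a⁻¹ * g * a) * formFun ε θ₂ μ₂ (b⁻¹ * g * b)) ∈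
      superCone ε := by
  have hA : ∀ h ∈ A, (⟨h, 0⟩ : TriGroup H J) ∈ K := fun h hh => (hKI _).2 ⟨hh, I.zero_mem⟩
  have hI : ∀ x, x ∈ I ↔ (⟨1, x⟩ : TriGroup H J) ∈ K := fun x => by
    rw [hKI]
    exact ⟨fun h => ⟨one_mem A, h⟩, fun h => h.2⟩
  set θ : H → ℂ := fun h => formFun ε θ₁ μ₁ (a⁻¹ * ⟨h, 0⟩ * a) *
    formFun ε θ₂ μ₂ (b⁻¹ * ⟨h, 0⟩ * b) with hθ
  set ν : Module.Dual k J := conjForm a μ₁ + conjForm b μ₂ with hν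
  have hν' : ∀ x, ν x = μ₁ (cj a x) + μ₂ (cj b x) := fun _ => rfl
  have hF : ∀ g ∈ K, formFun ε θ₁ μ₁ (a⁻¹ * g * a) * formFun ε θ₂ μ₂ (b⁻¹ * g * b) =
      formFun ε θ ν g := by
    intro g hg
    have hg0 := (hK _).1 (hA _ ((hKI g).1 hg).1)
    rw [p₁.formFun_conj_eq ε ((hK g).1 hg).1 hg0.1, p₂.formFun_conj_eq ε ((hK g).1 hg).2 hg0.2,
      formFun_apply ε θ, hν, LinearMap.add_apply, AddChar.map_add_eq_mul]
    ring
  rw [indFun_congr rfl hF]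
  refine indFun_form_mem_superCone hchar hε ?_ ?_ I K hKI ν ?_ ?_ ?_ ?_ ?_ ?_
  · have e : ∀ c : TriGroup H J, c⁻¹ * ⟨1, 0⟩ * c = 1 := fun c => by
      change c⁻¹ * 1 * c = 1
      group
    simp [hθ, e, formFun_apply, h_one, TriGroup.one_x, p₁.one, p₂.one]
  · intro h hh h' hh'
    have e : ∀ c : TriGroup H J, c⁻¹ * ⟨h * h', 0⟩ * c =
        (c⁻¹ * ⟨h, 0⟩ * c) * (c⁻¹ * ⟨h', 0⟩ * c) := fun c => by
      have : (⟨h * h', 0⟩ : TriGroup H J) = ⟨h, 0⟩ * ⟨h', 0⟩ := by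
        ext <;> simp [h_mul, TriGroup.mul_x]
      rw [this]
      group
    have m := (hK _).1 (hA h hh)
    have m' := (hK _).1 (hA h' hh')
    simp only [hθ, e, p₁.formFun_mul ε m.1 m'.1, p₂.formFun_mul ε m.2 m'.2]
    ring
  · intro x hx y
    have := I.sub_mem (hr ⟨1, y⟩ x hx) hx
    rwa [ract_one_add, add_sub_cancel_left] at this
  · intro h _ x hx
    have := hr ⟨h, 0⟩ x hx
    rwa [ract_apply, mul_zero, add_zero] at this
  · intro x hx y
    have m := (hK _).1 ((hI x).1 hx)
    rw [hν', p₁.apply_cj_mul m.1, p₂.apply_cj_mul m.2, add_zero]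
  · intro h hh x hx
    have m := (hK _).1 ((hI x).1 hx)
    have m' := (hK _).1 (hA h hh)
    rw [hν', hν', p₁.apply_cj_right m'.1 m.1, p₂.apply_cj_right m'.2 m.2]
  · intro h hh x
    have m' := (hK _).1 (hA h hh)
    rw [hI, hK]
    exact ⟨p₁.conj_sub_mem m'.1 x, p₂.conj_sub_mem m'.2 x⟩
  · intro h hh x
    have m' := (hK _).1 (hA h hh)
    rw [hν', hν', p₁.apply_cj_left m'.1, p₂.apply_cj_left m'.2]

theorem indFun_mul_mem_superCone [Finite k] [Finite H] [FiniteDimensional k J] [Finite J]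
    [Fintype (TriGroup H J)] (hchar : ¬ ringChar k ∣ Nat.card H) {ε : AddChar k ℂ} (hε : ε ≠ 1)
    {A₁ A₂ : Subgroup H} {θ₁ θ₂ : H → ℂ} {μ₁ μ₂ : Module.Dual k J}
    {S₁ S₂ : Subgroup (TriGroup H J)} (p₁ : IsFormPair A₁ θ₁ μ₁ S₁)
    (p₂ : IsFormPair A₂ θ₂ μ₂ S₂) :
    (fun g => indFun S₁ (formFun ε θ₁ μ₁) g * indFun S₂ (formFun ε θ₂ μ₂) g) ∈ superCone ε := by
  refine indFun_mul_indFun_mem _ S₁ S₂ _ _ (fun a ha g hg => p₁.formFun_conj_self ε ha hg)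
    (fun a ha g hg => p₂.formFun_conj_self ε ha hg) fun b K hK => ?_
  -- The x with 1 + x ∈ S₁ ∩ bS₂b⁻¹.
  let I : Submodule k J :=
    { carrier := {x | ∀ y, μ₁ (x * y) = 0 ∧ μ₂ (lact b⁻¹ x * y) = 0}
      zero_mem' := fun y => by simp
      add_mem' := fun {x x'} hx hx' y => by
        rw [map_add, add_mul, add_mul, map_add, map_add, (hx y).1, (hx y).2, (hx' y).1, (hx' y).2,
          add_zero]
        exact ⟨rfl, rfl⟩
      smul_mem' := fun c x hx y => by
        rw [lact_smul, smul_mul_assoc, smul_mul_assoc, map_smul, map_smul, (hx y).1, (hx y).2,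
          smul_zero]
        exact ⟨rfl, rfl⟩ }
  have hI : ∀ x, x ∈ I ↔ ∀ y, μ₁ (x * y) = 0 ∧ μ₂ (lact b⁻¹ x * y) = 0 := fun _ => Iff.rfl
  have hIK : ∀ x, (⟨1, x⟩ : TriGroup H J) ∈ K ↔ x ∈ I := by
    intro x
    have h1 := p₁.conj_one_add_mem_iff 1 x
    rw [inv_one, one_mul, mul_one, lact_one] at h1
    rw [hK, h1, p₂.conj_one_add_mem_iff, hI, forall_and]
  have hr : ∀ (g : TriGroup H J), ∀ x ∈ I, ract g x ∈ I := by
    intro g x hx y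
    rw [lact_ract, ract_apply_mul, ract_apply_mul]
    exact hx _
  obtain ⟨u, hu⟩ := exists_conj_split hchar K I hIK hr
  -- Replacing K by the split subgroup u⁻¹Ku leaves the induced function unchanged. The conjugating
  -- elements 1 and b become u⁻¹ and u⁻¹b, and I becomes u⁻¹I.
  rw [← indFun_conj K (K.comap (MulAut.conj u).toMonoidHom) _ u fun g => by simp]
  have e : ∀ g : TriGroup H J, b⁻¹ * (u * g * u⁻¹) * b = (u⁻¹ * b)⁻¹ * g * (u⁻¹ * b) := by
    intro g; group
  have e' : ∀ g : TriGroup H J, u * g * u⁻¹ = u⁻¹⁻¹ * g * u⁻¹ := fun g => by rw [inv_inv]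
  simp only [e]
  simp only [e']
  refine indFun_conj_inf_mem_superCone hchar hε p₁ p₂ u⁻¹ (u⁻¹ * b) _ (fun g => ?_)
    (K.map projH) (I.comap (lactₗ k u)) (fun g => ?_) fun g x hx => ?_
  · rw [Subgroup.mem_comap, ← e, ← e']
    exact hK _
  · rw [Subgroup.mem_comap, Submodule.mem_comap, lactₗ_apply]
    exact hu g
  · rw [Submodule.mem_comap, lactₗ_apply] at hx ⊢
    rw [lact_ract]
    exact hr _ _ hx

end Product

theorem exists_sum_of_mem_closure {G : Type*} {P : Set (G → ℂ)} {f : G → ℂ}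
    (hf : f ∈ AddSubmonoid.closure P) :
    ∃ (S : Finset (G → ℂ)) (m : (G → ℂ) → ℕ), (∀ φ ∈ S, φ ∈ P) ∧
      ∀ g, f g = ∑ φ ∈ S, (m φ : ℂ) * φ g := by
  classical
  obtain ⟨l, hl, rfl⟩ := AddSubmonoid.exists_multiset_of_mem_closure hf
  refine ⟨l.toFinset, fun φ => l.count φ, fun φ hφ => hl φ (Multiset.mem_toFinset.1 hφ),
    fun g => ?_⟩
  rw [Finset.sum_multiset_count, Finset.sum_apply]
  exact Finset.sum_congr rfl fun φ _ => by simp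

end Triangular

theorem mainTheorem3 {k H J : Type*} [Field k] [Finite k] [CommGroup H] [Finite H]
    [NonUnitalRing J] [Module k J] [IsScalarTower k J J] [SMulCommClass k J J]
    [FiniteDimensional k J]
    [DistribMulAction H J] [DistribMulAction Hᵐᵒᵖ J] [SMulCommClass H Hᵐᵒᵖ J]
    [SMulCommClass H k J] [SMulCommClass Hᵐᵒᵖ k J] [IsTriangularPair H J]
    (hchar : ¬ ringChar k ∣ Nat.card H)
    (ε : AddChar k ℂ) (hε : ε ≠ 1)
    (χ₁ χ₂ : TriGroup H J → ℂ)
    (h₁ : Triangular.IsSupercharacter ε χ₁) (h₂ : Triangular.IsSupercharacter ε χ₂) :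
    ∃ (S : Finset (TriGroup H J → ℂ)) (m : (TriGroup H J → ℂ) → ℕ),
      (∀ φ ∈ S, Triangular.IsSupercharacter ε φ) ∧
        ∀ g : TriGroup H J, χ₁ g * χ₂ g = ∑ φ ∈ S, (m φ : ℂ) * φ g := by
  have : Finite J := Module.finite_of_finite k
  have := Triangular.finite_triGroup H J
  have := Fintype.ofFinite (TriGroup H J)
  obtain ⟨α, μ, hμ, rfl⟩ := h₁
  obtain ⟨β, ν, hν, rfl⟩ := h₂
  rw [Triangular.inducedCharacter_stab_eq, Triangular.inducedCharacter_stab_eq]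
  exact Triangular.exists_sum_of_mem_closure (Triangular.indFun_mul_mem_superCone hchar hε
    (Triangular.isFormPair_stab α.idem (α.mem_dualCorner hμ) α.θ)
    (Triangular.isFormPair_stab β.idem (β.mem_dualCorner hν) β.θ))
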